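/- Let $K$ be a global field, $\mathbb A_K$ its ring of adeles, $C_K=\mathbb A_K^*/K^*$ its idele class group and $X_K=\mathbb A_K/K^*$ the adele class space, on which $C_K$ acts by multiplication. Fix a place $v$ of $K$ and let $|\cdot|_v$ be the normalized absolute value (the module of $K_v$). Let $\mathbb A^{(1)}_{K,v}$ be the set of adeles $a$ with $a_v=0$ and with $a_w$ in the interior of $\{x\in K_w : |x|\le 1\}$ for every place $w$, and let $$\mathcal G(v)=\{(k,x)\in K^*\times\mathbb A^{(1)}_{K,v} : kx\in\mathbb A^{(1)}_{K,v}\}$$ be the groupoid with source $x$, range $kx$ and product $(k_1,k_2x)(k_2,x)=(k_1k_2,x)$, with the topology induced from $K^*\times\mathbb A_K$, where $K^*$ is discrete. On $C_c(\mathcal G(v))$ consider the time evolution $\sigma^v_t(f)(k,x)=|k|_v^{it}f(k,x)$, $t\in\mathbb R$. For $y\in\mathbb A^{(1)}_{K,v}$ let $\mathcal G(v)_y$ be the set of elements with source $y$, and let $\pi_y$ be the representation of $C_c(\mathcal G(v))$ on $\ell^2(\mathcal G(v)_y)$ by left convolution, $$(\pi_y(f)\xi)(\gamma)=\sum_{\gamma_1\gamma_2=\gamma}f(\gamma_1)\,\xi(\gamma_2).$$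 Let $H_y$ be the operator $(H_y\xi)(k,y)=\log|k|_v\,\xi(k,y)$ on $\ell^2(\mathcal G(v)_y)$ with its maximal domain. Let $\Xi_{K,v}=C_K\,a^{(v)}\subset X_K$ be the orbit of the class of the adele $a^{(v)}$ with $a^{(v)}_v=0$ and $a^{(v)}_w=1$ for $w\ne v$. Then for every $y\in\mathbb A^{(1)}_{K,v}$ the Hamiltonian $H_y$ implements the time evolution, i.e. $\pi_y(\sigma^v_t(f))=e^{itH_y}\pi_y(f)e^{-itH_y}$ for all $t\in\mathbb R$ and $f\in C_c(\mathcal G(v))$, and the following are equivalent: 1. $H_y$ is bounded below; 2. $\pi_y$ is a positive energy representation, i.e. there is a self-adjoint operator $H$ on $\ell^2(\mathcal G(v)_y)$ that is bounded below and satisfies $\pi_y(\sigma^v_t(f))=e^{itH}\pi_y(f)e^{-itH}$ for all $t\in\mathbb R$ and $f\in C_c(\mathcal G(v))$; 3. the class of $y$ in $X_K$ belongs to $\Xi_{K,v}$. -/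

import Mathlib

noncomputable section
open IsDedekindDomain

/-- A global field: a number field, or a finite extension of `𝔽_p(t)` for some prime `p`. -/
class IsGlobalField (K : Type*) [Field K] : Prop where
  numberField_or_functionField : NumberField K ∨
    ∃ (p : ℕ) (_ : Fact p.Prime) (_ : Algebra (RatFunc (ZMod p)) K),
      FiniteDimensional (RatFunc (ZMod p)) K

theorem finite_valuationSubring_of_isFractionRing (R : Type*) {K : Type*} [CommRing R]
    [IsDedekindDomain R] [Field K] [Algebra R K] [IsFractionRing R K] (x : K) :
    {A : ValuationSubring K | A ≠ ⊤ ∧ (∀ r : R, algebraMap R K r ∈ A) ∧ x ∉ A}.Finite := by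
  refine ((HeightOneSpectrum.Support.finite R x).image
    fun v => (v.valuation K).valuationSubring).subset ?_
  rintro A ⟨hA, hR, hx⟩
  let f : R →+* A := (algebraMap R K).codRestrict A.toSubring hR
  let P : Ideal R := (IsLocalRing.maximalIdeal A).comap f
  have hmem : ∀ r : R, r ∉ P → (algebraMap R K r)⁻¹ ∈ A := by
    intro r hr
    by_contra h
    apply hr
    have h2 := (ValuationSubring.inv_mem_nonunits_iff (A := A)
      (x := (algebraMap R K r)⁻¹)).2 (Or.inr h)
    rw [inv_inv] at h2
    exact (ValuationSubring.coe_mem_nonunits_iff (a := f r)).1 h2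
  have hP : P ≠ ⊥ := by
    intro h0
    apply hA
    rw [eq_top_iff]
    intro z _
    obtain ⟨a, b, hb, rfl⟩ := IsFractionRing.div_surjective (A := R) z
    rw [div_eq_mul_inv]
    refine A.mul_mem _ _ (hR a) (hmem b ?_)
    rw [h0, Ideal.mem_bot]
    exact nonZeroDivisors.ne_zero hb
  let v : HeightOneSpectrum R := ⟨P, inferInstance, hP⟩
  have hle : HeightOneSpectrum.valuationSubringAtPrime K v ≤ A := by
    rintro z ⟨a, s, hs, rfl⟩
    exact A.mul_mem _ _ (hR a) (hmem s hs)
  have heq := ValuationSubring.eq_of_le_of_ne_top _ hle hA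
  rw [HeightOneSpectrum.valuationSubringAtPrime_eq_valuationSubring] at heq
  refine ⟨v, ?_, heq⟩
  rw [← heq, Valuation.mem_valuationSubring_iff, not_le] at hx
  exact hx

theorem finite_valuationSubring_of_isSeparable (R F : Type*) {E : Type*} [CommRing R]
    [IsDedekindDomain R] [Field F] [Field E] [Algebra R F] [IsFractionRing R F] [Algebra F E]
    [FiniteDimensional F E] [Algebra.IsSeparable F E] (x : E) :
    {A : ValuationSubring E | A ≠ ⊤ ∧ (∀ r : R, algebraMap F E (algebraMap R F r) ∈ A) ∧
      x ∉ A}.Finite := by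
  let : Algebra R E := ((algebraMap F E).comp (algebraMap R F)).toAlgebra
  have : IsScalarTower R F E := IsScalarTower.of_algebraMap_eq fun _ => rfl
  have := integralClosure.isDedekindDomain R F E
  have : IsFractionRing (integralClosure R E) E :=
    integralClosure.isFractionRing_of_finite_extension F E
  refine (finite_valuationSubring_of_isFractionRing (integralClosure R E) x).subset ?_
  rintro A ⟨hA, hR, hx⟩
  refine ⟨hA, fun r => ?_, hx⟩
  have hint : IsIntegral A (r : E) := by
    obtain ⟨q, hq, hq0⟩ := r.2
    refine ⟨q.map ((algebraMap R E).codRestrict A.toSubring hR), hq.map _, ?_⟩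
    rw [Polynomial.eval₂_map]
    exact hq0
  obtain ⟨a, ha⟩ := (IsIntegrallyClosed.isIntegral_iff (R := A) (K := E)).1 hint
  change (r : E) ∈ A
  rw [← ha]
  exact a.2

theorem ValuationSubring.map_zmod_mem {p : ℕ} {L : Type*} [Field L] (B : ValuationSubring L)
    (i : ZMod p →+* L) (c : ZMod p) : i c ∈ B := by
  rw [← ZMod.intCast_zmod_cast c, map_intCast]
  exact intCast_mem B _

theorem ValuationSubring.pow_mem_iff {L : Type*} [Field L] (B : ValuationSubring L) {n : ℕ}
    (hn : n ≠ 0) (z : L) : z ^ n ∈ B ↔ z ∈ B := by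
  rw [← B.valuation_le_one_iff, ← B.valuation_le_one_iff, map_pow, pow_le_one_iff hn]

/-- An element of a global field lies in all but finitely many valuation rings. -/
theorem finite_valuationSubring_notMem {K : Type*} [Field K] [IsGlobalField K] (x : K) :
    {A : ValuationSubring K | A ≠ ⊤ ∧ x ∉ A}.Finite := by
  rcases IsGlobalField.numberField_or_functionField (K := K) with h | ⟨p, hp, _, _⟩
  · refine (finite_valuationSubring_of_isSeparable ℤ ℚ x).subset ?_
    rintro A ⟨hA, hx⟩
    refine ⟨hA, fun r => ?_, hx⟩
    simp
  · let F := RatFunc (ZMod p)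
    let E := separableClosure F K
    have : DecidableEq F := Classical.decEq _
    have : CharP F p := charP_of_injective_algebraMap (algebraMap (ZMod p) F).injective p
    have : ExpChar F p := .prime hp.out
    have : CharP K p := charP_of_injective_algebraMap (algebraMap F K).injective p
    have hE : ∀ z : E, {A : ValuationSubring E | A ≠ ⊤ ∧ z ∉ A}.Finite := by
      intro z
      let O := (RatFunc.inftyValuation (ZMod p)).valuationSubring
      have : Nontrivial (MonoidWithZeroHom.valueGroup
          (.ofClass (RatFunc.inftyValuation (ZMod p)))) := by
        rw [Subgroup.nontrivial_iff_exists_ne_one]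
        refine ⟨Units.mk0 (RatFunc.inftyValuation (ZMod p) RatFunc.X) (by simp),
          MonoidWithZeroHom.mem_valueGroup _ ⟨RatFunc.X, by simp⟩, ?_⟩
        intro h
        have := congrArg Units.val h
        simp [← WithZero.exp_zero] at this
      refine ((finite_valuationSubring_of_isSeparable (Polynomial (ZMod p)) F z).union
        (finite_valuationSubring_of_isSeparable O F z)).subset ?_
      rintro A ⟨hA, hz⟩
      by_cases hX : algebraMap F E RatFunc.X ∈ A
      · refine Or.inl ⟨hA, fun r => ?_, hz⟩
        induction r using Polynomial.induction_on' with
        | add a b ha hb => simpa using A.add_mem _ _ ha hb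
        | monomial n c =>
          rw [← Polynomial.C_mul_X_pow_eq_monomial]
          simp only [map_mul, map_pow]
          exact A.mul_mem _ _ (A.map_zmod_mem (((algebraMap F E).comp
            (algebraMap (Polynomial (ZMod p)) F)).comp Polynomial.C) c) (pow_mem hX n)
      · refine Or.inr ⟨hA, fun r => ?_, hz⟩
        let B := A.comap (algebraMap F E)
        have : B.valuation.IsTrivialOn (ZMod p) := by
          refine ⟨fun c hc => ?_⟩
          apply le_antisymm
          · exact (B.valuation_le_one_iff _).2 (B.map_zmod_mem (algebraMap _ _) c)
          · have := (B.valuation_le_one_iff _).2 (B.map_zmod_mem (algebraMap _ _) c⁻¹)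
            rw [map_inv₀, map_inv₀] at this
            rwa [inv_le_one₀] at this
            simpa [zero_lt_iff] using hc
        have h1 : 1 < B.valuation RatFunc.X := by
          rw [← not_le, B.valuation_le_one_iff]
          exact hX
        have h2 := RatFunc.valuation_isEquiv_inftyValuation_of_one_lt_valuation_X h1
        have h3 := (Valuation.isEquiv_iff_valuationSubring _ _).1 h2
        rw [ValuationSubring.valuationSubring_valuation] at h3
        have : (r : F) ∈ B := by rw [h3]; exact r.2
        exact this
    obtain ⟨n, z, hz⟩ := IsPurelyInseparable.pow_mem E p x
    have hpow : ∀ (B : ValuationSubring K) (y : K) (m : ℕ) (u : E),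
        algebraMap E K u = y ^ p ^ m → (y ∈ B ↔ u ∈ B.comap (algebraMap E K)) := by
      intro B y m u hu
      rw [ValuationSubring.mem_comap, hu, B.pow_mem_iff (pow_ne_zero _ hp.out.ne_zero)]
    refine Set.Finite.of_finite_image (f := fun A => A.comap (algebraMap E K))
      ((hE z).subset ?_) ?_
    · rintro _ ⟨A, ⟨hA, hx⟩, rfl⟩
      refine ⟨fun htop => hA ?_, fun h => hx ((hpow A x n z hz).2 h)⟩
      rw [eq_top_iff]
      intro y _
      obtain ⟨m, u, hu⟩ := IsPurelyInseparable.pow_mem E p y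
      rw [hpow A y m u hu]
      have htop' : A.comap (algebraMap E K) = ⊤ := htop
      rw [htop']
      exact ValuationSubring.mem_top u
    · intro A _ B _ hAB
      ext y
      obtain ⟨m, u, hu⟩ := IsPurelyInseparable.pow_mem E p y
      rw [hpow A y m u hu, hpow B y m u hu]
      exact iff_of_eq (congrArg (fun C : ValuationSubring E => u ∈ C) hAB)

universe u

open scoped RestrictedProduct

/-- The places of a global field: the archimedean ones, and the nonarchimedean ones, given by
their valuation rings. (The nontrivial valuation subrings of a global field are exactly the
valuation rings of its nonarchimedean absolute values. In positive characteristic there are no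
field embeddings into `ℂ`, so `InfinitePlace K` is empty.) -/
inductive Place (K : Type u) [Field K] : Type u
  | infinite (v : NumberField.InfinitePlace K) : Place K
  | finite (A : ValuationSubring K) (hA : A ≠ ⊤) : Place K

namespace Place

variable {K : Type u} [Field K]

/-- The completion `K_w` of `K` at the place `w`. -/
def Completion : Place K → Type u
  | infinite v => v.Completion
  | finite A _ => A.valuation.Completion

instance : (w : Place K) → Field w.Completion
  | infinite v => inferInstanceAs (Field v.Completion)
  | finite A _ => inferInstanceAs (Field A.valuation.Completion)

instance : (w : Place K) → TopologicalSpace w.Completion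
  | infinite v => inferInstanceAs (TopologicalSpace v.Completion)
  | finite A _ => inferInstanceAs (TopologicalSpace A.valuation.Completion)

/-- The canonical embedding of `K` in `K_w`. -/
def embedding : (w : Place K) → K →+* w.Completion
  | infinite v => (algebraMap K v.Completion : K →+* v.Completion)
  | finite A _ => (UniformSpace.Completion.coeRingHom.comp
      (WithVal.equiv A.valuation).symm.toRingHom : K →+* A.valuation.Completion)

/-- The ring of integers of `K_w`, and all of `K_w` at an archimedean place. -/
def integers : (w : Place K) → Subring w.Completion
  | infinite _ => ⊤
  | finite A _ => (Valued.v : Valuation A.valuation.Completion _).integer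

/-- The set `{x ∈ K_w : |x| ≤ 1}`. -/
def closedUnitBall : (w : Place K) → Set w.Completion
  | infinite v => {x : v.Completion | ‖x‖ ≤ 1}
  | finite A _ => {x : A.valuation.Completion | Valued.v x ≤ 1}

open Classical in
/-- The normalized absolute value `|x|_w` on `K`, that is, the factor by which multiplication by
`x` scales the Haar measure of `K_w`: the usual absolute value at a real place, its square at a
complex place, and `[A : xA]⁻¹` for `0 ≠ x ∈ A` at the place with valuation ring `A`. -/
def absValue : Place K → K → ℝ
  | infinite v, x => v x ^ v.mult
  | finite A _, x =>
    if x = 0 then 0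
    else if h : x ∈ A then (Nat.card (A ⧸ Ideal.span {(⟨x, h⟩ : A)}) : ℝ)⁻¹
    else (Nat.card (A ⧸ Ideal.span {(⟨x⁻¹, (A.mem_or_inv_mem x).resolve_left h⟩ : A)}) : ℝ)

end Place

variable (K : Type u) [Field K]

/-- The adele ring `𝔸_K`, the restricted product of all completions. -/
abbrev AdeleRing : Type u :=
  Πʳ w : Place K, [w.Completion, w.integers]

variable {K}

theorem Place.eventually_embedding_mem_integers [IsGlobalField K] (x : K) :
    ∀ᶠ w : Place K in Filter.cofinite, w.embedding x ∈ w.integers := by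
  have h : {w : Place K | w.embedding x ∉ w.integers} ⊆
      {w | ∃ (A : ValuationSubring K) (hA : A ≠ ⊤), x ∉ A ∧ w = Place.finite A hA} := by
    rintro (v | ⟨A, hA⟩) hw
    · exact absurd (Subring.mem_top _) hw
    · refine ⟨A, hA, fun hx => hw ?_, rfl⟩
      change Valued.v ((((WithVal.equiv A.valuation).symm x : WithVal A.valuation) :
        A.valuation.Completion)) ≤ 1
      rw [Valued.valuedCompletion_apply]
      exact (A.valuation_le_one_iff x).2 hx
  have : Finite {A : ValuationSubring K | A ≠ ⊤ ∧ x ∉ A} := finite_valuationSubring_notMem x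
  refine (Set.finite_range fun A : {A : ValuationSubring K | A ≠ ⊤ ∧ x ∉ A} =>
    Place.finite A.1 A.2.1).subset ?_
  rintro w hw
  obtain ⟨A, hA, hx, rfl⟩ := h hw
  exact ⟨⟨A, hA, hx⟩, rfl⟩

/-- The diagonal embedding of `K` in its adele ring. -/
def AdeleRing.diagonal [IsGlobalField K] : K →+* AdeleRing K where
  toFun x := RestrictedProduct.mk (fun w => w.embedding x)
    (Place.eventually_embedding_mem_integers x)
  map_one' := by ext w; exact map_one w.embedding
  map_mul' x y := by ext w; exact map_mul w.embedding x y
  map_zero' := by ext w; exact map_zero w.embedding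
  map_add' x y := by ext w; exact map_add w.embedding x y

instance [IsGlobalField K] : Algebra K (AdeleRing K) := AdeleRing.diagonal.toAlgebra

variable (K) in
/-- The adele class space `X_K = 𝔸_K / K^*`. -/
abbrev AdeleClassSpace [IsGlobalField K] : Type u :=
  MulAction.orbitRel.Quotient Kˣ (AdeleRing K)

variable (K) in
/-- The image of `K^*` in the group of ideles. -/
abbrev principalIdeles [IsGlobalField K] : Subgroup (AdeleRing K)ˣ :=
  (Units.map (algebraMap K (AdeleRing K) : K →* AdeleRing K)).range

variable (K) in
/-- The idele class group `C_K = 𝔸_K^* / K^*`. -/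
abbrev IdeleClassGroup [IsGlobalField K] : Type u :=
  (AdeleRing K)ˣ ⧸ principalIdeles K

/-- The class of an adele in `X_K`. -/
def adeleClass [IsGlobalField K] (a : AdeleRing K) : AdeleClassSpace K := Quotient.mk _ a

/-- The action of `C_K` on `X_K` by multiplication. -/
instance [IsGlobalField K] : MulAction (IdeleClassGroup K) (AdeleClassSpace K) where
  smul c x := Quotient.liftOn₂' c x (fun j a => adeleClass ((j : AdeleRing K) * a)) (by
    rintro j a j' a' hj ⟨k, rfl⟩
    obtain ⟨l, hl⟩ := QuotientGroup.leftRel_apply.1 hj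
    refine Quotient.sound ⟨l⁻¹ * k, ?_⟩
    have hj' : j' = j * Units.map (algebraMap K (AdeleRing K) : K →* AdeleRing K) l := by
      rw [hl]; group
    subst hj'
    simp only [Units.smul_def, Algebra.smul_def, Units.val_mul, Units.coe_map, map_mul,
      MonoidHom.coe_coe]
    have hl1 : algebraMap K (AdeleRing K) (l⁻¹ : Kˣ) * algebraMap K (AdeleRing K) l = 1 := by
      rw [← map_mul, Units.inv_mul, map_one]
    linear_combination (algebraMap K (AdeleRing K) k * j * a') * hl1)
  one_smul x := by
    induction x using Quotient.inductionOn' with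
    | h a => exact congrArg adeleClass (one_mul a)
  mul_smul c d x := by
    induction c using Quotient.inductionOn' with
    | h i =>
    induction d using Quotient.inductionOn' with
    | h j =>
    induction x using Quotient.inductionOn' with
    | h a => exact congrArg adeleClass (mul_assoc (i : AdeleRing K) j a)

open Classical in
/-- The adele `a^{(v)}` with component `0` at `v` and `1` at all other places. -/
def basePoint (v : Place K) : AdeleRing K :=
  RestrictedProduct.mk (fun w => if w = v then 0 else 1) (by
    refine Filter.Eventually.of_forall fun w => ?_
    by_cases h : w = v
    · simp only [h, if_true]; exact zero_mem _
    · simp only [h, if_false]; exact one_mem _)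

/-- The orbit `Ξ_{K,v} = C_K a^{(v)}` in `X_K`. -/
def classicalOrbit [IsGlobalField K] (v : Place K) : Set (AdeleClassSpace K) :=
  MulAction.orbit (IdeleClassGroup K) (adeleClass (basePoint v))

/-- The set `𝔸^{(1)}_{K,v}` of adeles with `a_v = 0` and with `a_w` in the interior of
`{|x| ≤ 1} ⊆ K_w` at every place `w`. -/
def unitSpace (v : Place K) : Set (AdeleRing K) :=
  {a | a v = 0 ∧ ∀ w : Place K, a w ∈ interior w.closedUnitBall}

/-- The groupoid `𝒢(v)` of pairs `(k, x)` with `x` and `k x` both in `𝔸^{(1)}_{K,v}`. -/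
@[ext]
structure ValuationGroupoid [IsGlobalField K] (v : Place K) : Type u where
  k : Kˣ
  x : AdeleRing K
  source_mem : x ∈ unitSpace v
  range_mem : k • x ∈ unitSpace v

namespace ValuationGroupoid

variable [IsGlobalField K] {v : Place K}

/-- The topology of `K^* × 𝔸_K`, where `K^*` is discrete. -/
instance : TopologicalSpace (ValuationGroupoid v) :=
  TopologicalSpace.induced (fun γ => (γ.k, γ.x))
    (@instTopologicalSpaceProd Kˣ (AdeleRing K) ⊥ inferInstance)

def source (γ : ValuationGroupoid v) : unitSpace v := ⟨γ.x, γ.source_mem⟩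

def range (γ : ValuationGroupoid v) : unitSpace v := ⟨γ.k • γ.x, γ.range_mem⟩

/-- The product `(k₁, k₂ x) (k₂, x) = (k₁ k₂, x)`. -/
def comp (γ₁ γ₂ : ValuationGroupoid v) (h : γ₁.source = γ₂.range) : ValuationGroupoid v where
  k := γ₁.k * γ₂.k
  x := γ₂.x
  source_mem := γ₂.source_mem
  range_mem := by
    have h' : γ₁.x = γ₂.k • γ₂.x := congrArg Subtype.val h
    rw [mul_smul, ← h']
    exact γ₁.range_mem

/-- The inverse `(k⁻¹, k x)` of `(k, x)`. -/
def inv (γ : ValuationGroupoid v) : ValuationGroupoid v where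
  k := γ.k⁻¹
  x := γ.k • γ.x
  source_mem := γ.range_mem
  range_mem := by rw [inv_smul_smul]; exact γ.source_mem

theorem source_eq_range_inv {γ₁ γ₂ : ValuationGroupoid v} (h : γ₁.source = γ₂.source) :
    γ₁.source = γ₂.inv.range := by
  rw [h]
  exact Subtype.ext (inv_smul_smul γ₂.k γ₂.x).symm

theorem continuous_of_k {Y : Type*} [TopologicalSpace Y] (g : Kˣ → Y) :
    Continuous fun γ : ValuationGroupoid v => g γ.k := by
  let : TopologicalSpace Kˣ := ⊥
  have : DiscreteTopology Kˣ := ⟨rfl⟩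
  have h : Continuous fun γ : ValuationGroupoid v => (γ.k, γ.x) := continuous_induced_dom
  exact (continuous_of_discreteTopology (f := g)).comp (continuous_fst.comp h)

/-- The set `𝒢(v)_y` of elements with source `y`. -/
abbrev Fiber (y : unitSpace v) : Type u := {γ : ValuationGroupoid v // γ.source = y}

/-- The product `γ γ₂⁻¹` of `γ, γ₂ ∈ 𝒢(v)_y`; it is the unique `γ₁` with `γ₁ γ₂ = γ`. -/
def Fiber.div {y : unitSpace v} (γ γ₂ : Fiber y) : ValuationGroupoid v :=
  γ.1.comp γ₂.1.inv (source_eq_range_inv (γ.2.trans γ₂.2.symm))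

end ValuationGroupoid

open ValuationGroupoid

/-- Schur's test for a matrix with finitely supported rows. -/
theorem schur_bound {I : Type*} {a : I → I → ℂ} {M : ℝ}
    (hrow : ∀ i, ∀ s : Finset I, ∑ j ∈ s, ‖a i j‖ ≤ M)
    (hcol : ∀ j, ∀ s : Finset I, ∑ i ∈ s, ‖a i j‖ ≤ M)
    (hfin : ∀ i, {j | a i j ≠ 0}.Finite) (ξ : lp (fun _ : I => ℂ) 2) (s : Finset I) :
    ∑ i ∈ s, ‖∑' j, a i j * ξ j‖ ^ 2 ≤ (M * ‖ξ‖) ^ 2 := by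
  classical
  let t : Finset I := s.biUnion fun i => (hfin i).toFinset
  have hsum : ∀ i ∈ s, ∑' j, a i j * ξ j = ∑ j ∈ t, a i j * ξ j := by
    intro i hi
    refine tsum_eq_sum fun j hj => ?_
    have : a i j = 0 := by
      by_contra h
      exact hj (Finset.mem_biUnion.2 ⟨i, hi, (hfin i).mem_toFinset.2 h⟩)
    rw [this, zero_mul]
  have hξ : ∑ j ∈ t, ‖ξ j‖ ^ 2 ≤ ‖ξ‖ ^ 2 := by
    have := lp.sum_rpow_le_norm_rpow (p := 2) (by simp) ξ t
    simpa using this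
  have key : ∀ i ∈ s, ‖∑' j, a i j * ξ j‖ ^ 2 ≤ M * ∑ j ∈ t, ‖a i j‖ * ‖ξ j‖ ^ 2 := by
    intro i hi
    rw [hsum i hi]
    have h1 : ‖∑ j ∈ t, a i j * ξ j‖ ≤ ∑ j ∈ t, ‖a i j‖ * ‖ξ j‖ :=
      (norm_sum_le _ _).trans (by simp)
    have h2 : (∑ j ∈ t, ‖a i j‖ * ‖ξ j‖) ^ 2 ≤
        (∑ j ∈ t, ‖a i j‖) * ∑ j ∈ t, ‖a i j‖ * ‖ξ j‖ ^ 2 :=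
      Finset.sum_sq_le_sum_mul_sum_of_sq_le_mul _ (fun j _ => norm_nonneg _)
        (fun j _ => by positivity) (fun j _ => le_of_eq (by ring))
    calc ‖∑ j ∈ t, a i j * ξ j‖ ^ 2 ≤ (∑ j ∈ t, ‖a i j‖ * ‖ξ j‖) ^ 2 := by gcongr
      _ ≤ _ := h2
      _ ≤ _ := by
        gcongr
        exact hrow i t
  by_cases hs : s = ∅
  · subst hs
    simpa using sq_nonneg _
  obtain ⟨i₀, -⟩ := Finset.nonempty_iff_ne_empty.2 hs
  have hM : 0 ≤ M := by simpa using hrow i₀ ∅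
  calc ∑ i ∈ s, ‖∑' j, a i j * ξ j‖ ^ 2
      ≤ ∑ i ∈ s, M * ∑ j ∈ t, ‖a i j‖ * ‖ξ j‖ ^ 2 := Finset.sum_le_sum key
    _ = M * ∑ j ∈ t, (∑ i ∈ s, ‖a i j‖) * ‖ξ j‖ ^ 2 := by
        rw [← Finset.mul_sum, Finset.sum_comm]
        simp_rw [Finset.sum_mul]
    _ ≤ M * ∑ j ∈ t, M * ‖ξ j‖ ^ 2 := by
        gcongr with j _
        exact hcol j s
    _ = M ^ 2 * ∑ j ∈ t, ‖ξ j‖ ^ 2 := by rw [← Finset.mul_sum]; ring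
    _ ≤ M ^ 2 * ‖ξ‖ ^ 2 := by gcongr
    _ = (M * ‖ξ‖) ^ 2 := by ring

theorem exists_schur_bound [IsGlobalField K] {v : Place K} (y : unitSpace v)
    (f : CompactlySupportedContinuousMap (ValuationGroupoid v) ℂ) :
    ∃ M : ℝ, (∀ γ : Fiber y, ∀ s : Finset (Fiber y), ∑ γ₂ ∈ s, ‖f (γ.div γ₂)‖ ≤ M) ∧
      (∀ γ₂ : Fiber y, ∀ s : Finset (Fiber y), ∑ γ ∈ s, ‖f (γ.div γ₂)‖ ≤ M) ∧
      ∀ γ : Fiber y, {γ₂ : Fiber y | f (γ.div γ₂) ≠ 0}.Finite := by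
  classical
  obtain ⟨C, hC⟩ := f.hasCompactSupport.exists_bound_of_continuous f.continuous
  have hfin : ((fun γ : ValuationGroupoid v => γ.k) '' tsupport f).Finite := by
    let : TopologicalSpace Kˣ := ⊥
    have : DiscreteTopology Kˣ := ⟨rfl⟩
    exact (f.hasCompactSupport.image (continuous_of_k fun k => k)).finite_of_discrete
  let S : Finset Kˣ := hfin.toFinset
  have hS : ∀ γ, f γ ≠ 0 → γ.k ∈ S := fun γ hγ =>
    hfin.mem_toFinset.2 ⟨γ, subset_tsupport _ hγ, rfl⟩
  have hx : ∀ γ : Fiber y, γ.1.x = y.1 := fun γ => congrArg Subtype.val γ.2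
  have hk : ∀ γ γ' : Fiber y, γ.1.k = γ'.1.k → γ = γ' := fun γ γ' h =>
    Subtype.ext (ValuationGroupoid.ext h ((hx γ).trans (hx γ').symm))
  have inj₂ : ∀ γ : Fiber y, Function.Injective fun γ₂ : Fiber y => (γ.div γ₂).k := by
    intro γ γ₂ γ₂' h
    exact hk _ _ (inv_injective (mul_left_cancel h))
  have inj₁ : ∀ γ₂ : Fiber y, Function.Injective fun γ : Fiber y => (γ.div γ₂).k := by
    intro γ₂ γ γ' h
    exact hk _ _ (mul_right_cancel h)
  have bound : ∀ (e : Fiber y → ValuationGroupoid v), (Function.Injective fun γ => (e γ).k) →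
      ∀ s : Finset (Fiber y), ∑ γ ∈ s, ‖f (e γ)‖ ≤ S.card * |C| := by
    intro e he s
    rw [← Finset.sum_filter_add_sum_filter_not s fun γ => f (e γ) ≠ 0]
    have h0 : ∑ γ ∈ s with ¬ f (e γ) ≠ 0, ‖f (e γ)‖ = 0 :=
      Finset.sum_eq_zero fun γ hγ => by simpa using (Finset.mem_filter.1 hγ).2
    rw [h0, add_zero]
    calc _ ≤ ∑ γ ∈ s with f (e γ) ≠ 0, |C| :=
          Finset.sum_le_sum fun γ _ => (hC _).trans (le_abs_self C)
      _ = ((s.filter fun γ => f (e γ) ≠ 0).card : ℝ) * |C| := by simp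
      _ ≤ _ := by
        gcongr
        exact Finset.card_le_card_of_injOn (fun γ => (e γ).k)
          (fun γ hγ => hS _ (Finset.mem_filter.1 hγ).2) he.injOn
  refine ⟨S.card * |C|, fun γ => bound _ (inj₂ γ), fun γ₂ => bound _ (inj₁ γ₂), fun γ => ?_⟩
  refine Set.Finite.of_finite_image (f := fun γ₂ : Fiber y => (γ.div γ₂).k)
    (S.finite_toSet.subset ?_) (inj₂ γ).injOn
  rintro _ ⟨γ₂, h, rfl⟩
  exact hS _ h

/-- The regular representation `π_y` of `C_c(𝒢(v))` on `ℓ²(𝒢(v)_y)` by left convolution,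
`(π_y(f) ξ)(γ) = ∑_{γ₁ γ₂ = γ} f(γ₁) ξ(γ₂)`. -/
def regularRep [IsGlobalField K] {v : Place K} (y : unitSpace v)
    (f : CompactlySupportedContinuousMap (ValuationGroupoid v) ℂ) :
    lp (fun _ : Fiber y => ℂ) 2 →L[ℂ] lp (fun _ : Fiber y => ℂ) 2 :=
  LinearMap.mkContinuousOfExistsBound
    { toFun := fun ξ => ⟨fun γ => ∑' γ₂ : Fiber y, f (γ.div γ₂) * ξ γ₂, by
        obtain ⟨M, hrow, hcol, hfin⟩ := exists_schur_bound y f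
        exact memℓp_gen' (C := (M * ‖ξ‖) ^ 2) fun s => by
          simpa using schur_bound hrow hcol hfin ξ s⟩
      map_add' := fun ξ η => by
        obtain ⟨M, hrow, hcol, hfin⟩ := exists_schur_bound y f
        have hs : ∀ (γ : Fiber y) (ζ : lp (fun _ : Fiber y => ℂ) 2),
            Summable fun γ₂ => f (γ.div γ₂) * ζ γ₂ := fun γ ζ =>
          summable_of_hasFiniteSupport ((hfin γ).subset fun γ₂ h h0 => h (by simp [h0]))
        ext γ
        simp only [lp.coeFn_add, Pi.add_apply, mul_add]
        exact (hs γ ξ).tsum_add (hs γ η)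
      map_smul' := fun c ξ => by
        ext γ
        simp only [lp.coeFn_smul, Pi.smul_apply, smul_eq_mul, RingHom.id_apply, ← tsum_mul_left]
        exact tsum_congr fun γ₂ => by ring }
    (by
      obtain ⟨M, hrow, hcol, hfin⟩ := exists_schur_bound y f
      refine ⟨|M|, fun ξ => lp.norm_le_of_forall_sum_le (by simp) (by positivity) fun s => ?_⟩
      have h := schur_bound hrow hcol hfin ξ s
      rw [← sq_abs, abs_mul, abs_norm] at h
      simpa using h)

/-- The time evolution `σ_t(f)(k, x) = |k|_v^{it} f(k, x)` on `C_c(𝒢(v))`. -/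
def timeEvolution [IsGlobalField K] (v : Place K) (t : ℝ)
    (f : CompactlySupportedContinuousMap (ValuationGroupoid v) ℂ) :
    CompactlySupportedContinuousMap (ValuationGroupoid v) ℂ where
  toFun γ := ((v.absValue γ.k : ℝ) : ℂ) ^ (Complex.I * t) * f γ
  continuous_toFun :=
    (continuous_of_k fun k : Kˣ => ((v.absValue k : ℝ) : ℂ) ^ (Complex.I * t)).mul f.continuous
  hasCompactSupport' := f.hasCompactSupport.mul_left

/-- The operator `(H_y ξ)(k, y) = log |k|_v ξ(k, y)` on `ℓ²(𝒢(v)_y)`, with its maximal domain. -/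
def hamiltonian [IsGlobalField K] {v : Place K} (y : unitSpace v) :
    lp (fun _ : Fiber y => ℂ) 2 →ₗ.[ℂ] lp (fun _ : Fiber y => ℂ) 2 where
  domain :=
    { carrier := {ξ | Memℓp (fun γ : Fiber y => (Real.log (v.absValue γ.1.k) : ℂ) * ξ γ) 2}
      zero_mem' := by simpa using zero_mem_ℓp'
      add_mem' := fun {ξ η} hξ hη => by
        have h := Memℓp.add hξ hη
        refine (congrArg (fun g => Memℓp g 2) ?_).mp h
        funext γ
        simp [mul_add]
      smul_mem' := fun c ξ hξ => by
        have h := Memℓp.const_smul hξ c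
        refine (congrArg (fun g => Memℓp g 2) ?_).mp h
        funext γ
        simp [mul_left_comm] }
  toFun :=
    { toFun := fun ξ => ⟨fun γ => (Real.log (v.absValue γ.1.k) : ℂ) * ξ.1 γ, ξ.2⟩
      map_add' := fun ξ η => by ext γ; exact mul_add _ _ _
      map_smul' := fun c ξ => by ext γ; simp [mul_left_comm] }

section PositiveEnergy

variable {H : Type*} [NormedAddCommGroup H] [InnerProductSpace ℂ H]

/-- `U` is a strongly continuous one-parameter group of unitaries whose generator is `D`, that is,
`U t = e^{itD}`: `ξ` is in the domain of `D` with `D ξ = η` iff `t ↦ U t ξ` has derivative `i η`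
at `0`. (By Stone's theorem, `D` is then self-adjoint.) -/
structure IsUnitaryGroupGeneratedBy (U : ℝ → H ≃ₗᵢ[ℂ] H) (D : H →ₗ.[ℂ] H) : Prop where
  map_add : ∀ s t ξ, U (s + t) ξ = U s (U t ξ)
  continuous : ∀ ξ, Continuous fun t => U t ξ
  generator : ∀ ξ η, (ξ, η) ∈ D.graph ↔ HasDerivAt (fun t => U t ξ) (Complex.I • η) 0

/-- The Hamiltonian `D` implements the time evolution `σ` in the representation `π`:
`π(σ_t(b)) = e^{itD} π(b) e^{-itD}`. -/
def Implements {B : Type*} (π : B → H →L[ℂ] H) (σ : ℝ → B → B) (D : H →ₗ.[ℂ] H) : Prop :=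
  ∃ U : ℝ → H ≃ₗᵢ[ℂ] H, IsUnitaryGroupGeneratedBy U D ∧
    ∀ t b ξ, π (σ t b) ξ = U t (π b (U (-t) ξ))

/-- The operator `D` is bounded below: `⟨ξ, D ξ⟩ ≥ c ‖ξ‖²` on its domain, for some real `c`. -/
def IsBoundedBelow (D : H →ₗ.[ℂ] H) : Prop :=
  ∃ c : ℝ, ∀ ξ : D.domain, c * ‖(ξ : H)‖ ^ 2 ≤ (inner ℂ (ξ : H) (D ξ)).re

/-- `π` is a positive energy representation for `σ`: the time evolution is implemented by some
Hamiltonian that is bounded below. -/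
def IsPositiveEnergy {B : Type*} (π : B → H →L[ℂ] H) (σ : ℝ → B → B) : Prop :=
  ∃ D : H →ₗ.[ℂ] H, Implements π σ D ∧ IsBoundedBelow D

end PositiveEnergy

end

/-!
The Hamiltonian is multiplication by `log |k|_v` on the fibre over `y`, so it is bounded below iff
`|k|_v` is bounded away from `0` as `k` runs over the multipliers with `k y` again in the unit
space. Convolution by a bump function concentrated on one arrow `k` shifts the energy by
`log |k|_v`, so every positive energy representation forces the same lower bound.

The class of `y` lies in the classical orbit iff `y_w ≠ 0` for all `w ≠ v` and `y_w` is a unit at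
almost all `w`. In that case the multipliers `k` with `|k|_v ≤ 1` are bounded at every place, and
there are only finitely many of them. Otherwise `y` tolerates large multipliers: either at one
place `w₀ ≠ v` where `y` vanishes, or by a bounded amount at infinitely many places. This freedom
makes room for `k` with `|k|_v` arbitrarily small, by Minkowski's theorem for number fields and by
a pigeonhole argument on polynomials for function fields.
-/

open IsDedekindDomain ValuationGroupoid Filter Topology

section FiniteQuotients

variable {R M : Type*} [CommRing R] [AddCommGroup M] [Module R M]

theorem card_le_of_subset_map_span {ι : Type*} [Fintype ι] {g : R} [Finite (R ⧸ Ideal.span {g})]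
    {N : Submodule R M} (hN : ∀ m, g • m ∈ N) (b : ι → M) {s : Finset (M ⧸ N)}
    (hs : (s : Set (M ⧸ N)) ⊆ (Submodule.span R (Set.range b)).map N.mkQ) :
    s.card ≤ Nat.card (R ⧸ Ideal.span {g}) ^ Fintype.card ι := by
  have hker (i : ι) :
      Ideal.span {g} ≤ LinearMap.ker (LinearMap.toSpanSingleton R (M ⧸ N) (N.mkQ (b i))) := by
    rw [Ideal.span_singleton_le_iff_mem, LinearMap.mem_ker, LinearMap.toSpanSingleton_apply,
      ← map_smul, Submodule.mkQ_apply, Submodule.Quotient.mk_eq_zero]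
    exact hN _
  let φ (c : ι → R ⧸ Ideal.span {g}) : M ⧸ N :=
    ∑ i, (Ideal.span {g}).liftQ _ (hker i) (c i)
  have hφ : (s : Set (M ⧸ N)) ⊆ Set.range φ := by
    intro x hx
    obtain ⟨m, hm, rfl⟩ := hs hx
    obtain ⟨c, rfl⟩ := (Submodule.mem_span_range_iff_exists_fun R).1 hm
    exact ⟨fun i => Submodule.Quotient.mk (c i), by simp only [φ, map_sum, map_smul]; rfl⟩
  calc s.card = Set.ncard (s : Set (M ⧸ N)) := (Set.ncard_coe_finset s).symm
    _ ≤ Set.ncard (Set.range φ) := Set.ncard_le_ncard hφ (Set.finite_range φ)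
    _ ≤ Nat.card (ι → R ⧸ Ideal.span {g}) := Finite.card_range_le φ
    _ = _ := by rw [Nat.card_fun, Nat.card_eq_fintype_card (α := ι)]

theorem card_le_of_rank_le [IsDomain R] [IsPrincipalIdealRing R] [Module.IsTorsionFree R M] {n : ℕ}
    (hn : Module.rank R M ≤ n) {g : R} [Finite (R ⧸ Ideal.span {g})] {N : Submodule R M}
    (hN : ∀ m, g • m ∈ N) (s : Finset (M ⧸ N)) :
    s.card ≤ Nat.card (R ⧸ Ideal.span {g}) ^ n := by
  classical
  let P : Submodule R M := Submodule.span R (s.image Quotient.out : Finset M)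
  have : Module.Finite R P := Module.Finite.span_finset R _
  let b := Module.finBasis R P
  have hb : Submodule.span R (Set.range fun i => (b i : M)) = P := by
    rw [Set.range_comp' Subtype.val b, ← P.coe_subtype, ← Submodule.map_span, b.span_eq,
      Submodule.map_top, P.range_subtype]
  refine (card_le_of_subset_map_span hN (fun i => (b i : M)) fun x hx => ?_).trans
    (Nat.pow_le_pow_right Nat.card_pos ?_)
  · rw [hb]
    exact ⟨_, Submodule.subset_span (Finset.mem_image_of_mem _ hx), Quotient.out_eq x⟩
  · rw [Fintype.card_fin]
    exact Module.finrank_le_of_rank_le ((Submodule.rank_le P).trans hn)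

theorem finite_quotient_of_rank_le [IsDomain R] [IsPrincipalIdealRing R]
    [Module.IsTorsionFree R M] {n : ℕ} (hn : Module.rank R M ≤ n) {g : R}
    [Finite (R ⧸ Ideal.span {g})] {N : Submodule R M} (hN : ∀ m, g • m ∈ N) : Finite (M ⧸ N) := by
  by_contra h
  rw [not_finite_iff_infinite] at h
  obtain ⟨s, hs⟩ := Infinite.exists_subset_card_eq (M ⧸ N) (Nat.card (R ⧸ Ideal.span {g}) ^ n + 1)
  exact absurd (card_le_of_rank_le hn hN s) (by lia)

theorem natCard_quotient_le_of_rank_le [IsDomain R] [IsPrincipalIdealRing R]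
    [Module.IsTorsionFree R M] {n : ℕ} (hn : Module.rank R M ≤ n) {g : R}
    [Finite (R ⧸ Ideal.span {g})] {N : Submodule R M} (hN : ∀ m, g • m ∈ N) :
    Nat.card (M ⧸ N) ≤ Nat.card (R ⧸ Ideal.span {g}) ^ n := by
  have := finite_quotient_of_rank_le hn hN
  have := Fintype.ofFinite (M ⧸ N)
  rw [Nat.card_eq_fintype_card (α := M ⧸ N)]
  exact card_le_of_rank_le hn hN Finset.univ

theorem natCard_quotient_span_mul {S : Type*} [CommRing S] [IsDomain S] {u : S} (hu : u ≠ 0)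
    (I : Ideal S) :
    Nat.card (S ⧸ (Ideal.span {u} * I)) = Nat.card (S ⧸ Ideal.span {u}) * Nat.card (S ⧸ I) := by
  let f : S →+ S := AddMonoidHom.mulLeft u
  have hf : Function.Injective f := mul_right_injective₀ hu
  have hI : (Ideal.span {u} * I).toAddSubgroup = I.toAddSubgroup.map f := by
    ext x
    simp [Ideal.mem_span_singleton_mul, f]
  have htop : (Ideal.span {u}).toAddSubgroup = (⊤ : AddSubgroup S).map f := by
    ext x
    simp [Ideal.mem_span_singleton, f, dvd_def, eq_comm]
  have h := AddSubgroup.relIndex_mul_index (H := (Ideal.span {u} * I).toAddSubgroup)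
    (K := (Ideal.span {u}).toAddSubgroup)
    (Ideal.mul_le_left (I := Ideal.span {u}) (J := I))
  rw [hI, htop, AddSubgroup.relIndex_map_map_of_injective _ _ hf, AddSubgroup.relIndex_top_right,
    ← hI, ← htop, mul_comm] at h
  exact h.symm

theorem natCard_polynomial_quotient {F : Type*} [Field F] [Finite F] {g : Polynomial F}
    (hg : g ≠ 0) : Nat.card (Polynomial F ⧸ Ideal.span {g}) = Nat.card F ^ g.natDegree := by
  have : Module.Finite F (Polynomial F ⧸ Ideal.span {g}) := (AdjoinRoot.powerBasis hg).finite
  have h : Module.finrank F (Polynomial F ⧸ Ideal.span {g}) = g.natDegree :=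
    finrank_quotient_span_eq_natDegree
  rw [← h]
  exact Module.natCard_eq_pow_finrank

instance hasFiniteQuotients_polynomial {F : Type*} [Field F] [Finite F] :
    Ring.HasFiniteQuotients (Polynomial F) where
  finiteQuotient {I} hI := by
    obtain ⟨g, hgI, hg⟩ := Submodule.exists_mem_ne_zero_of_ne_bot hI
    have : Module.Finite F (Polynomial F ⧸ Ideal.span {g}) := (AdjoinRoot.powerBasis hg).finite
    have : Finite (Polynomial F ⧸ Ideal.span {g}) := Module.finite_of_finite F
    exact Finite.of_surjective _
      (Ideal.Quotient.factor_surjective ((Ideal.span_singleton_le_iff_mem I).2 hgI))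

theorem natCard_quotient_span_singleton_mul {S : Type*} [CommRing S] [IsDomain S] {x : S}
    (hx : x ≠ 0) (y : S) : Nat.card (S ⧸ Ideal.span {x * y}) =
      Nat.card (S ⧸ Ideal.span {x}) * Nat.card (S ⧸ Ideal.span {y}) := by
  rw [← natCard_quotient_span_mul hx, Ideal.span_singleton_mul_span_singleton]

theorem natCard_quotient_span_singleton_pos {S : Type*} [CommRing S] [Ring.HasFiniteQuotients S]
    {x : S} (hx : x ≠ 0) : 0 < Nat.card (S ⧸ Ideal.span {x}) := by
  have := Ring.HasFiniteQuotients.finiteQuotient (mt Ideal.span_singleton_eq_bot.1 hx)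
  exact Nat.card_pos

end FiniteQuotients

section FractionField

universe u

theorem isTorsionFree_of_isFractionRing (R F K : Type*) {B : Type*} [CommRing R] [IsDomain R]
    [Field F] [Field K] [Algebra R F] [IsFractionRing R F] [Algebra F K] [Algebra R K]
    [IsScalarTower R F K] [CommRing B] [Algebra R B] [Algebra B K] [IsScalarTower R B K]
    [FaithfulSMul B K] : Module.IsTorsionFree R B := by
  have : FaithfulSMul R K := (faithfulSMul_iff_algebraMap_injective R K).2 <| by
    rw [IsScalarTower.algebraMap_eq R F K]
    exact (algebraMap F K).injective.comp (IsFractionRing.injective R F)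
  exact Function.Injective.moduleIsTorsionFree (IsScalarTower.toAlgHom R B K)
    (FaithfulSMul.algebraMap_injective B K) fun r b => map_smul _ r b

variable (R F : Type*) (K : Type u) {B : Type u} [CommRing R] [Field F] [Field K]
  [Algebra R F] [IsFractionRing R F] [Algebra F K] [FiniteDimensional F K] [Algebra R K]
  [IsScalarTower R F K] [CommRing B] [Algebra R B] [Algebra B K] [IsScalarTower R B K]
  [FaithfulSMul B K]

theorem rank_le_finrank_of_isFractionRing : Module.rank R B ≤ Module.finrank F K := by
  refine ((IsScalarTower.toAlgHom R B K).toLinearMap.rank_le_of_injective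
    (FaithfulSMul.algebraMap_injective B K)).trans ?_
  rw [← IsLocalization.rank_eq F (nonZeroDivisors R) le_rfl, Module.finrank_eq_rank]

theorem natCard_quotient_le_pow_finrank [IsDomain R] [IsPrincipalIdealRing R] {g : R}
    [Finite (R ⧸ Ideal.span {g})] {I : Ideal B} (hg : algebraMap R B g ∈ I) :
    Nat.card (B ⧸ I) ≤ Nat.card (R ⧸ Ideal.span {g}) ^ Module.finrank F K := by
  have : Module.IsTorsionFree R B := isTorsionFree_of_isFractionRing R F K
  refine natCard_quotient_le_of_rank_le (N := I.restrictScalars R)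
    (rank_le_finrank_of_isFractionRing R F K) fun b => ?_
  rw [Algebra.smul_def]
  exact Ideal.mul_mem_right _ _ hg

theorem hasFiniteQuotients_of_isFractionRing (R F : Type*) (K : Type u) {B : Type u} [CommRing R]
    [IsDomain R] [IsPrincipalIdealRing R] [Ring.HasFiniteQuotients R] [Field F] [Field K]
    [Algebra R F] [IsFractionRing R F] [Algebra F K] [FiniteDimensional F K] [Algebra R K]
    [IsScalarTower R F K] [CommRing B] [Algebra R B] [Algebra B K] [IsScalarTower R B K]
    [FaithfulSMul B K] : Ring.HasFiniteQuotients B where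
  finiteQuotient {I} hI := by
    have : Module.IsTorsionFree R B := isTorsionFree_of_isFractionRing R F K
    have : IsDomain B := (FaithfulSMul.algebraMap_injective B K).isDomain
    have : Algebra.IsAlgebraic R K :=
      (IsFractionRing.comap_isAlgebraic_iff (A := R) (K := F) (C := K)).2 inferInstance
    obtain ⟨x, hxI, hx⟩ := Submodule.exists_mem_ne_zero_of_ne_bot hI
    have hxalg : IsAlgebraic R x := by
      rw [← isAlgebraic_algebraMap_iff (A := K) (FaithfulSMul.algebraMap_injective B K)]
      exact Algebra.IsAlgebraic.isAlgebraic _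
    obtain ⟨g, hg, hxg⟩ := hxalg.exists_nonzero_dvd (mem_nonZeroDivisors_of_ne_zero hx)
    have : Finite (R ⧸ Ideal.span {g}) :=
      Ring.HasFiniteQuotients.finiteQuotient (mt Ideal.span_singleton_eq_bot.1 hg)
    refine finite_quotient_of_rank_le (N := I.restrictScalars R)
      (rank_le_finrank_of_isFractionRing R F K) (g := g) fun b => ?_
    rw [Algebra.smul_def]
    exact Ideal.mul_mem_right _ _ (I.mem_of_dvd hxg hxI)

end FractionField

section FunctionField

theorem exists_ratFunc_algEquiv_X_eq_inv (F : Type*) [Field F] :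
    ∃ σ : RatFunc F ≃ₐ[F] RatFunc F, σ RatFunc.X = RatFunc.X⁻¹ := by
  have htr : Transcendental F (RatFunc.X⁻¹ : RatFunc F) := by
    rw [Transcendental, IsAlgebraic.inv_iff]
    exact RatFunc.transcendental_X
  have htop : IntermediateField.adjoin F {(RatFunc.X⁻¹ : RatFunc F)} = ⊤ := by
    rw [← top_le_iff, ← RatFunc.adjoin_X, IntermediateField.adjoin_simple_le_iff]
    simpa only [inv_inv] using
      inv_mem (IntermediateField.mem_adjoin_simple_self F (RatFunc.X⁻¹ : RatFunc F))
  refine ⟨(RatFunc.algEquivOfTranscendental _ htr).trans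
    ((IntermediateField.equivOfEq htop).trans IntermediateField.topEquiv), ?_⟩
  simp

variable {K : Type*} [Field K] {p : ℕ} [Fact p.Prime] [Algebra (RatFunc (ZMod p)) K]

theorem exists_algebra_ratFunc_mem [FiniteDimensional (RatFunc (ZMod p)) K]
    (A : ValuationSubring K) :
    ∃ (_ : Algebra (RatFunc (ZMod p)) K) (_ : FiniteDimensional (RatFunc (ZMod p)) K),
      algebraMap (RatFunc (ZMod p)) K RatFunc.X ∈ A := by
  rcases A.mem_or_inv_mem (algebraMap (RatFunc (ZMod p)) K RatFunc.X) with h | h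
  · exact ⟨_, inferInstance, h⟩
  · obtain ⟨σ, hσ⟩ := exists_ratFunc_algEquiv_X_eq_inv (ZMod p)
    let φ := algebraMap (RatFunc (ZMod p)) K
    have hφ : φ.comp (σ : RatFunc (ZMod p) →+* RatFunc (ZMod p)) RatFunc.X ∈ A := by
      change φ (σ RatFunc.X) ∈ A
      rwa [hσ, map_inv₀]
    refine ⟨(φ.comp σ).toAlgebra, ?_, hφ⟩
    refine @Module.Finite.of_equiv_equiv (RatFunc (ZMod p)) K (RatFunc (ZMod p)) K _ _ _ _ _
      (φ.comp σ).toAlgebra σ.symm.toRingEquiv (RingEquiv.refl K) ?_ ‹_›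
    ext r
    exact congrArg φ (σ.apply_symm_apply r)

theorem algebraMap_polynomial_mem {A : ValuationSubring K}
    (hA : algebraMap (RatFunc (ZMod p)) K RatFunc.X ∈ A) (q : Polynomial (ZMod p)) :
    algebraMap (RatFunc (ZMod p)) K (algebraMap _ _ q) ∈ A := by
  induction q using Polynomial.induction_on' with
  | add a b ha hb => simpa only [map_add] using A.add_mem _ _ ha hb
  | monomial n c =>
    rw [← Polynomial.C_mul_X_pow_eq_monomial]
    simp only [map_mul, map_pow, RatFunc.algebraMap_X]
    exact A.mul_mem _ _ (A.map_zmod_mem (((algebraMap (RatFunc (ZMod p)) K).comp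
      (algebraMap (Polynomial (ZMod p)) (RatFunc (ZMod p)))).comp Polynomial.C) c) (pow_mem hA n)

theorem isEmpty_infinitePlace_of_algebra_ratFunc (K : Type*) [Field K] (p : ℕ) [Fact p.Prime]
    [Algebra (RatFunc (ZMod p)) K] : IsEmpty (NumberField.InfinitePlace K) := by
  refine ⟨fun w => ?_⟩
  let i : ZMod p →+* ℂ := (w.embedding.comp (algebraMap (RatFunc (ZMod p)) K)).comp
    (algebraMap (ZMod p) (RatFunc (ZMod p)))
  have : CharP ℂ p := charP_of_injective_ringHom i.injective p
  exact (Fact.out : p.Prime).ne_zero (CharP.eq ℂ this (CharP.ofCharZero ℂ))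

end FunctionField

theorem hasFiniteQuotients_of_algebraMap_mem (R F : Type*) {K : Type*} [CommRing R] [IsDomain R]
    [IsPrincipalIdealRing R] [Ring.HasFiniteQuotients R] [Field F] [Field K] [Algebra R F]
    [IsFractionRing R F] [Algebra F K] [FiniteDimensional F K] (A : ValuationSubring K)
    (hA : ∀ r : R, algebraMap F K (algebraMap R F r) ∈ A) : Ring.HasFiniteQuotients A := by
  let : Algebra R K := ((algebraMap F K).comp (algebraMap R F)).toAlgebra
  have : IsScalarTower R F K := IsScalarTower.of_algebraMap_eq fun _ => rfl
  let : Algebra R A := ((algebraMap R K).codRestrict A.toSubring hA).toAlgebra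
  have : IsScalarTower R A K := IsScalarTower.of_algebraMap_eq fun _ => rfl
  exact hasFiniteQuotients_of_isFractionRing R F K

instance hasFiniteQuotients_valuationSubring {K : Type*} [Field K] [IsGlobalField K]
    (A : ValuationSubring K) : Ring.HasFiniteQuotients A := by
  rcases IsGlobalField.numberField_or_functionField (K := K) with h | ⟨p, hp, _, _⟩
  · exact hasFiniteQuotients_of_algebraMap_mem ℤ ℚ A fun r => by simp
  · obtain ⟨_, _, hX⟩ := exists_algebra_ratFunc_mem (p := p) A
    exact hasFiniteQuotients_of_algebraMap_mem (Polynomial (ZMod p)) (RatFunc (ZMod p)) A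
      (algebraMap_polynomial_mem hX)

namespace Place

variable {K : Type*} [Field K]

theorem exists_eq_div_valuationSubring (A : ValuationSubring K) {x : K} (hx : x ≠ 0) :
    ∃ a b : A, a ≠ 0 ∧ b ≠ 0 ∧ x = a / b := by
  rcases A.mem_or_inv_mem x with h | h
  · exact ⟨⟨x, h⟩, 1, fun h0 => hx (congrArg Subtype.val h0), one_ne_zero, by simp⟩
  · exact ⟨1, ⟨x⁻¹, h⟩, one_ne_zero, fun h0 => inv_ne_zero hx (congrArg Subtype.val h0), by simp⟩

theorem absValue_zero (w : Place K) : w.absValue 0 = 0 := by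
  rcases w with w | ⟨A, hA⟩
  · simp [absValue, NumberField.InfinitePlace.mult_ne_zero]
  · simp [absValue]

variable [IsGlobalField K]

theorem absValue_finite_div (A : ValuationSubring K) (hA : A ≠ ⊤) {a b : A} (ha : a ≠ 0)
    (hb : b ≠ 0) : (Place.finite A hA).absValue ((a : K) / b) =
      Nat.card (A ⧸ Ideal.span {b}) / Nat.card (A ⧸ Ideal.span {a}) := by
  have ha' : (a : K) ≠ 0 := by simpa using ha
  have hb' : (b : K) ≠ 0 := by simpa using hb
  have pa : (Nat.card (A ⧸ Ideal.span {a}) : ℝ) ≠ 0 :=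
    Nat.cast_ne_zero.2 (natCard_quotient_span_singleton_pos ha).ne'
  have pb : (Nat.card (A ⧸ Ideal.span {b}) : ℝ) ≠ 0 :=
    Nat.cast_ne_zero.2 (natCard_quotient_span_singleton_pos hb).ne'
  rw [absValue, if_neg (div_ne_zero ha' hb')]
  split_ifs with h
  · have hab : b * ⟨(a : K) / b, h⟩ = a := Subtype.ext (mul_div_cancel₀ _ hb')
    have hcard := natCard_quotient_span_singleton_mul hb ⟨(a : K) / b, h⟩
    rw [hab] at hcard
    rw [hcard, Nat.cast_mul] at pa ⊢
    field_simp
  · have h' := (A.mem_or_inv_mem _).resolve_left h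
    have hba : a * ⟨((a : K) / b)⁻¹, h'⟩ = b := Subtype.ext (by simp [mul_div_cancel₀ _ ha'])
    have hcard := natCard_quotient_span_singleton_mul ha ⟨((a : K) / b)⁻¹, h'⟩
    rw [hba] at hcard
    rw [hcard, Nat.cast_mul]
    field_simp

theorem absValue_pos (w : Place K) {x : K} (hx : x ≠ 0) : 0 < w.absValue x := by
  rcases w with w | ⟨A, hA⟩
  · exact pow_pos (w.pos_iff.2 hx) _
  · obtain ⟨a, b, ha, hb, rfl⟩ := exists_eq_div_valuationSubring A hx
    rw [absValue_finite_div A hA ha hb]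
    have := natCard_quotient_span_singleton_pos ha
    have := natCard_quotient_span_singleton_pos hb
    positivity

theorem absValue_mul (w : Place K) (x y : K) :
    w.absValue (x * y) = w.absValue x * w.absValue y := by
  by_cases hx : x = 0
  · simp [hx, absValue_zero]
  by_cases hy : y = 0
  · simp [hy, absValue_zero]
  rcases w with w | ⟨A, hA⟩
  · simp [absValue, mul_pow]
  · obtain ⟨a, b, ha, hb, rfl⟩ := exists_eq_div_valuationSubring A hx
    obtain ⟨c, d, hc, hd, rfl⟩ := exists_eq_div_valuationSubring A hy
    have hmul : (a : K) / b * (c / d) = (a * c : A) / (b * d : A) := by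
      push_cast
      rw [div_mul_div_comm]
    rw [hmul, absValue_finite_div A hA ha hb, absValue_finite_div A hA hc hd,
      absValue_finite_div A hA (mul_ne_zero ha hc) (mul_ne_zero hb hd),
      natCard_quotient_span_singleton_mul ha, natCard_quotient_span_singleton_mul hb]
    push_cast
    rw [div_mul_div_comm]

/-- The normalized absolute value of a place, as a homomorphism of monoids with zero. -/
noncomputable def absValueHom (w : Place K) : K →*₀ ℝ where
  toFun := w.absValue
  map_zero' := w.absValue_zero
  map_one' := by
    have h := w.absValue_mul 1 1
    rw [one_mul] at h
    exact (mul_eq_left₀ (w.absValue_pos one_ne_zero).ne').1 h.symm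
  map_mul' := w.absValue_mul

theorem absValue_inv (w : Place K) (x : K) : w.absValue x⁻¹ = (w.absValue x)⁻¹ :=
  map_inv₀ w.absValueHom x

theorem absValue_pow (w : Place K) (x : K) (n : ℕ) : w.absValue (x ^ n) = w.absValue x ^ n :=
  map_pow w.absValueHom x n

theorem absValue_finite_le_one {A : ValuationSubring K} (hA : A ≠ ⊤) {x : K} (hx : x ∈ A) :
    (Place.finite A hA).absValue x ≤ 1 := by
  by_cases h0 : x = 0
  · simp [h0, absValue_zero]
  have hpos := natCard_quotient_span_singleton_pos (x := (⟨x, hx⟩ : A))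
    fun h => h0 (congrArg Subtype.val h)
  rw [absValue, if_neg h0, dif_pos hx]
  exact inv_le_one_of_one_le₀ (by exact_mod_cast hpos)

theorem absValue_finite_lt_one {A : ValuationSubring K} (hA : A ≠ ⊤) {x : K}
    (hx : x ∈ A.nonunits) : (Place.finite A hA).absValue x < 1 := by
  by_cases h0 : x = 0
  · simp [h0, absValue_zero]
  have hxA : x ∈ A := ValuationSubring.nonunits_subset hx
  have hne : (⟨x, hxA⟩ : A) ≠ 0 := fun h => h0 (congrArg Subtype.val h)
  have := Ring.HasFiniteQuotients.finiteQuotient (mt Ideal.span_singleton_eq_bot.1 hne)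
  have : Nontrivial (A ⧸ Ideal.span {(⟨x, hxA⟩ : A)}) := Ideal.Quotient.nontrivial_iff.2 fun h =>
    (ValuationSubring.coe_mem_nonunits_iff (a := ⟨x, hxA⟩)).1 hx (Ideal.span_singleton_eq_top.1 h)
  rw [absValue, if_neg h0, dif_pos hxA]
  exact inv_lt_one_of_one_lt₀ (Nat.one_lt_cast.2 Finite.one_lt_card)

theorem absValue_finite_le_one_iff {A : ValuationSubring K} (hA : A ≠ ⊤) {x : K} :
    (Place.finite A hA).absValue x ≤ 1 ↔ x ∈ A := by
  refine ⟨fun h => ?_, absValue_finite_le_one hA⟩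
  by_contra hx
  have hlt := absValue_finite_lt_one hA (A.inv_mem_nonunits_iff.2 (Or.inr hx))
  have h0 : x ≠ 0 := by rintro rfl; exact hx A.zero_mem
  rw [absValue_inv, inv_lt_one₀ (absValue_pos _ h0)] at hlt
  exact absurd h (not_le.2 hlt)

end Place

theorem exists_mem_nonunits_ne_zero {K : Type*} [Field K] {A : ValuationSubring K}
    (hA : A ≠ ⊤) : ∃ x ∈ A.nonunits, x ≠ 0 := by
  by_contra! h
  refine hA (top_unique (SetLike.le_def.2 fun {x} _ => ?_))
  by_contra hx
  have hinv := h _ (A.inv_mem_nonunits_iff.2 (Or.inr hx))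
  exact hx (inv_eq_zero.1 hinv ▸ A.zero_mem)

section Diagonal

variable {I : Type*}

theorem tendsto_lp_of_dominated {α : Type*} {l : Filter α} {F : α → lp (fun _ : I => ℂ) 2}
    {G : lp (fun _ : I => ℂ) 2} {B : I → ℂ} (hB : Memℓp B 2)
    (hF : ∀ᶠ a in l, ∀ i, ‖F a i - G i‖ ≤ ‖B i‖)
    (hlim : ∀ i, Tendsto (fun a => F a i) l (𝓝 (G i))) : Tendsto F l (𝓝 G) := by
  have hnorm (ξ : lp (fun _ : I => ℂ) 2) : ‖ξ‖ ^ 2 = ∑' i, ‖ξ i‖ ^ 2 := by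
    simpa using lp.norm_rpow_eq_tsum (p := 2) (by simp) ξ
  have hsum : Summable fun i => ‖B i‖ ^ 2 := by simpa using hB.summable (by simp)
  have hpoint (i : I) : Tendsto (fun a => ‖F a i - G i‖ ^ 2) l (𝓝 0) := by
    simpa using ((tendsto_sub_nhds_zero_iff.2 (hlim i)).norm).pow 2
  have hsq : Tendsto (fun a => ‖F a - G‖ ^ 2) l (𝓝 0) := by
    have h := tendsto_tsum_of_dominated_convergence hsum hpoint <| hF.mono fun a ha i => by
      rw [Real.norm_of_nonneg (by positivity)]
      gcongr
      exact ha i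
    rw [tsum_zero] at h
    exact h.congr fun a => (hnorm (F a - G)).symm
  rw [← tendsto_sub_nhds_zero_iff, tendsto_zero_iff_norm_tendsto_zero]
  simpa [Real.sqrt_sq] using hsq.sqrt

/-- Multiplication by a function of modulus one, as a linear isometry of `ℓ²(I)`. -/
noncomputable def diagonalIsometry (u : I → ℂ) (hu : ∀ i, ‖u i‖ = 1) :
    lp (fun _ : I => ℂ) 2 →ₗᵢ[ℂ] lp (fun _ : I => ℂ) 2 where
  toFun ξ := ⟨fun i => u i * ξ i, (lp.memℓp ξ).mono'
    fun i => le_of_eq (by rw [norm_mul, hu, one_mul])⟩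
  map_add' ξ η := by ext i; exact mul_add _ _ _
  map_smul' c ξ := by ext i; simp [mul_left_comm]
  norm_map' ξ := by
    rw [lp.norm_eq_tsum_rpow (by simp), lp.norm_eq_tsum_rpow (by simp)]
    simp [hu]

/-- The unitary group `t ↦ e^{itℓ}` on `ℓ²(I)` generated by multiplication by the real function
`ℓ`. -/
noncomputable def diagonalGroup (ℓ : I → ℝ) (t : ℝ) :
    lp (fun _ : I => ℂ) 2 ≃ₗᵢ[ℂ] lp (fun _ : I => ℂ) 2 :=
  { diagonalIsometry (fun i => Complex.exp ((t * ℓ i : ℝ) * Complex.I))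
      (fun i => Complex.norm_exp_ofReal_mul_I _) with
    invFun := diagonalIsometry (fun i => Complex.exp ((-t * ℓ i : ℝ) * Complex.I))
      (fun i => Complex.norm_exp_ofReal_mul_I _)
    left_inv := fun ξ => by
      ext i
      change Complex.exp _ * (Complex.exp _ * ξ i) = ξ i
      rw [← mul_assoc, ← Complex.exp_add]
      simp
    right_inv := fun ξ => by
      ext i
      change Complex.exp _ * (Complex.exp _ * ξ i) = ξ i
      rw [← mul_assoc, ← Complex.exp_add]
      simp }

variable (ℓ : I → ℝ)

theorem diagonalGroup_apply (t : ℝ) (ξ : lp (fun _ : I => ℂ) 2) (i : I) :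
    diagonalGroup ℓ t ξ i = Complex.exp ((t * ℓ i : ℝ) * Complex.I) * ξ i := rfl

theorem diagonalGroup_zero (ξ : lp (fun _ : I => ℂ) 2) : diagonalGroup ℓ 0 ξ = ξ := by
  ext i
  simp [diagonalGroup_apply]

theorem diagonalGroup_add (s t : ℝ) (ξ : lp (fun _ : I => ℂ) 2) :
    diagonalGroup ℓ (s + t) ξ = diagonalGroup ℓ s (diagonalGroup ℓ t ξ) := by
  ext i
  simp only [diagonalGroup_apply]
  rw [← mul_assoc, ← Complex.exp_add]
  congr 2
  push_cast
  ring

theorem continuous_diagonalGroup (ξ : lp (fun _ : I => ℂ) 2) :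
    Continuous fun t => diagonalGroup ℓ t ξ := by
  refine continuous_iff_continuousAt.2 fun s => tendsto_lp_of_dominated (B := fun i => 2 * ξ i)
    (Memℓp.const_mul (𝕜 := ℂ) (lp.memℓp ξ) 2) (Eventually.of_forall fun t i => ?_) fun i => ?_
  · rw [diagonalGroup_apply, diagonalGroup_apply]
    refine (norm_sub_le _ _).trans_eq ?_
    rw [norm_mul, norm_mul, norm_mul, Complex.norm_exp_ofReal_mul_I, Complex.norm_exp_ofReal_mul_I,
      Complex.norm_ofNat]
    ring
  · simp only [diagonalGroup_apply]
    exact Continuous.tendsto (by fun_prop) s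

theorem hasDerivAt_exp_ofReal_mul_I (r : ℝ) :
    HasDerivAt (fun t : ℝ => Complex.exp ((t * r : ℝ) * Complex.I)) (r * Complex.I) 0 := by
  have h : HasDerivAt (fun t : ℝ => ((t * r : ℝ) : ℂ) * Complex.I)
      (((1 * r : ℝ) : ℂ) * Complex.I) 0 :=
    (((hasDerivAt_id (0 : ℝ)).mul_const r).ofReal_comp).mul_const Complex.I
  simpa using h.cexp

theorem hasDerivAt_diagonalGroup_apply (ξ : lp (fun _ : I => ℂ) 2) (i : I) :
    HasDerivAt (fun t => diagonalGroup ℓ t ξ i) (Complex.I * (ℓ i * ξ i)) 0 := by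
  rw [← mul_assoc, mul_comm Complex.I]
  exact (hasDerivAt_exp_ofReal_mul_I (ℓ i)).mul_const (ξ i)

theorem norm_slope_diagonalGroup_le {t : ℝ} (ht : t ≠ 0) (ξ : lp (fun _ : I => ℂ) 2) (i : I) :
    ‖(t⁻¹ • (diagonalGroup ℓ t ξ - ξ)) i‖ ≤ ‖ℓ i * ξ i‖ := by
  have hslope : (t⁻¹ • (diagonalGroup ℓ t ξ - ξ)) i =
      (t⁻¹ : ℝ) * (Complex.exp (Complex.I * (t * ℓ i : ℝ)) - 1) * ξ i := by
    change t⁻¹ • (diagonalGroup ℓ t ξ i - ξ i) = _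
    rw [diagonalGroup_apply, Complex.real_smul, mul_comm Complex.I]
    ring
  rw [hslope, norm_mul, norm_mul, norm_mul, Complex.norm_real, Complex.norm_real]
  gcongr
  calc ‖t⁻¹‖ * ‖Complex.exp (Complex.I * (t * ℓ i : ℝ)) - 1‖
    _ ≤ ‖t⁻¹‖ * ‖t * ℓ i‖ := by gcongr; exact Real.norm_exp_I_mul_ofReal_sub_one_le
    _ = ‖ℓ i‖ := by rw [← norm_mul, inv_mul_cancel_left₀ ht]

theorem hasDerivAt_diagonalGroup_iff (ξ η : lp (fun _ : I => ℂ) 2) :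
    HasDerivAt (fun t => diagonalGroup ℓ t ξ) (Complex.I • η) 0 ↔ ∀ i, η i = ℓ i * ξ i := by
  refine ⟨fun h i => ?_, fun h => ?_⟩
  · have hi : HasDerivAt (fun t => diagonalGroup ℓ t ξ i) (Complex.I * η i) 0 :=
      (((lp.evalCLM (𝕜 := ℂ) (fun _ : I => ℂ) 2 i).restrictScalars ℝ).hasFDerivAt).comp_hasDerivAt
        (0 : ℝ) h
    exact mul_left_cancel₀ Complex.I_ne_zero (hi.unique (hasDerivAt_diagonalGroup_apply ℓ ξ i))
  · have hη (i : I) : (Complex.I • η : lp (fun _ : I => ℂ) 2) i = Complex.I * (ℓ i * ξ i) := by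
      rw [← h i]
      rfl
    rw [hasDerivAt_iff_tendsto_slope_zero]
    refine tendsto_lp_of_dominated (B := fun i => 2 * η i)
      (Memℓp.const_mul (𝕜 := ℂ) (lp.memℓp η) 2) ?_ fun i => ?_
    · filter_upwards [self_mem_nhdsWithin] with t ht i
      rw [zero_add, diagonalGroup_zero, hη]
      calc _ ≤ ‖(t⁻¹ • (diagonalGroup ℓ t ξ - ξ)) i‖ + ‖Complex.I * (ℓ i * ξ i)‖ :=
            norm_sub_le _ _
        _ ≤ ‖ℓ i * ξ i‖ + ‖ℓ i * ξ i‖ := by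
            rw [norm_mul Complex.I, Complex.norm_I, one_mul]
            gcongr
            exact norm_slope_diagonalGroup_le ℓ ht ξ i
        _ = ‖2 * η i‖ := by rw [← h i, norm_mul, Complex.norm_ofNat, two_mul]
    · rw [hη]
      exact (hasDerivAt_iff_tendsto_slope_zero.1 (hasDerivAt_diagonalGroup_apply ℓ ξ i)).congr
        fun t => rfl

end Diagonal

section Hamiltonian

variable {K : Type*} [Field K] [IsGlobalField K] {v : Place K}

/-- The eigenvalues `log |k|_v` of the Hamiltonian `H_y`, indexed by the arrows `(k, y)` with
source `y`. -/
noncomputable def energy (y : unitSpace v) (γ : Fiber y) : ℝ := Real.log (v.absValue γ.1.k)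

theorem mem_graph_hamiltonian_iff (y : unitSpace v) (ξ η : lp (fun _ : Fiber y => ℂ) 2) :
    (ξ, η) ∈ (hamiltonian y).graph ↔ ∀ γ, η γ = energy y γ * ξ γ := by
  rw [LinearPMap.mem_graph_iff]
  constructor
  · rintro ⟨z, rfl : (z : lp (fun _ : Fiber y => ℂ) 2) = ξ, rfl : hamiltonian y z = η⟩ γ
    rfl
  · intro h
    have hξ : ξ ∈ (hamiltonian y).domain :=
      (congrArg (fun g => Memℓp g 2) (funext h)).mp (lp.memℓp η)
    refine ⟨⟨ξ, hξ⟩, rfl, ?_⟩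
    ext γ
    exact (h γ).symm

theorem Place.cpow_absValue (v : Place K) (k : Kˣ) (t : ℝ) :
    ((v.absValue k : ℝ) : ℂ) ^ (Complex.I * t) =
      Complex.exp ((t * Real.log (v.absValue k) : ℝ) * Complex.I) := by
  have h := v.absValue_pos k.ne_zero
  rw [Complex.cpow_def_of_ne_zero (by exact_mod_cast h.ne'), ← Complex.ofReal_log h.le]
  congr 1
  push_cast
  ring

theorem Place.log_absValue_mul_inv (v : Place K) (k l : Kˣ) :
    Real.log (v.absValue (k * l⁻¹ : Kˣ)) = Real.log (v.absValue k) - Real.log (v.absValue l) := by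
  rw [Units.val_mul, Units.val_inv_eq_inv_val, v.absValue_mul, v.absValue_inv,
    Real.log_mul (v.absValue_pos k.ne_zero).ne' (inv_ne_zero (v.absValue_pos l.ne_zero).ne'),
    Real.log_inv, sub_eq_add_neg]

theorem timeEvolution_div (y : unitSpace v) (t : ℝ)
    (f : CompactlySupportedContinuousMap (ValuationGroupoid v) ℂ) (γ γ₂ : Fiber y) :
    timeEvolution v t f (γ.div γ₂) =
      Complex.exp ((t * energy y γ : ℝ) * Complex.I) * f (γ.div γ₂) *
        Complex.exp ((-t * energy y γ₂ : ℝ) * Complex.I) := by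
  change ((v.absValue (γ.1.k * γ₂.1.k⁻¹ : Kˣ) : ℝ) : ℂ) ^ (Complex.I * t) * f (γ.div γ₂) = _
  rw [v.cpow_absValue, v.log_absValue_mul_inv, mul_right_comm, ← Complex.exp_add, energy, energy]
  congr 2
  push_cast
  ring

theorem implements_hamiltonian (y : unitSpace v) :
    Implements (regularRep y) (timeEvolution v) (hamiltonian y) := by
  refine ⟨diagonalGroup (energy y), ⟨diagonalGroup_add _, continuous_diagonalGroup _,
    fun ξ η => ?_⟩, fun t f ξ => ?_⟩
  · exact (mem_graph_hamiltonian_iff y ξ η).trans (hasDerivAt_diagonalGroup_iff _ ξ η).symm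
  · ext γ
    rw [diagonalGroup_apply]
    change ∑' γ₂ : Fiber y, timeEvolution v t f (γ.div γ₂) * ξ γ₂ =
      _ * ∑' γ₂ : Fiber y, f (γ.div γ₂) * diagonalGroup (energy y) (-t) ξ γ₂
    rw [← tsum_mul_left]
    refine tsum_congr fun γ₂ => ?_
    rw [diagonalGroup_apply, timeEvolution_div]
    ring

theorem isBoundedBelow_hamiltonian (y : unitSpace v) {c : ℝ} (hc : ∀ γ, c ≤ energy y γ) :
    IsBoundedBelow (hamiltonian y) := by
  refine ⟨c, fun ξ => ?_⟩
  have hinner : HasSum (fun γ => (inner ℂ (ξ.1 γ) (hamiltonian y ξ γ)).re)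
      (inner ℂ (ξ : lp (fun _ : Fiber y => ℂ) 2) (hamiltonian y ξ)).re :=
    Complex.hasSum_re (lp.hasSum_inner _ _)
  have hnorm : HasSum (fun γ => c * (inner ℂ (ξ.1 γ) (ξ.1 γ)).re)
      (c * (inner ℂ (ξ : lp (fun _ : Fiber y => ℂ) 2) (ξ : lp (fun _ : Fiber y => ℂ) 2)).re) :=
    (Complex.hasSum_re (lp.hasSum_inner _ _)).mul_left c
  rw [← inner_self_eq_norm_sq (𝕜 := ℂ)]
  refine hasSum_le (fun γ => ?_) hnorm hinner
  have hξ : hamiltonian y ξ γ = energy y γ * ξ.1 γ := rfl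
  have hre : (inner ℂ (ξ.1 γ) (energy y γ * ξ.1 γ)).re =
      energy y γ * (inner ℂ (ξ.1 γ) (ξ.1 γ)).re := by
    rw [← smul_eq_mul, inner_smul_right, Complex.re_ofReal_mul]
  rw [hξ, hre]
  exact mul_le_mul_of_nonneg_right (hc γ) (inner_self_nonneg (𝕜 := ℂ) (x := ξ.1 γ))

end Hamiltonian

namespace IsUnitaryGroupGeneratedBy

variable {H : Type*} [NormedAddCommGroup H] [InnerProductSpace ℂ H] {U : ℝ → H ≃ₗᵢ[ℂ] H}
  {D : H →ₗ.[ℂ] H}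

theorem map_zero (hU : IsUnitaryGroupGeneratedBy U D) (ξ : H) : U 0 ξ = ξ := by
  have h := hU.map_add 0 0 ξ
  rw [add_zero] at h
  exact ((U 0).injective h).symm

theorem apply_mem_graph (hU : IsUnitaryGroupGeneratedBy U D) {T : H →L[ℂ] H} {μ : ℝ}
    (hT : ∀ t ξ, Complex.exp ((t * μ : ℝ) * Complex.I) • T ξ = U t (T (U (-t) ξ))) {ξ η : H}
    (h : (ξ, η) ∈ D.graph) : (T ξ, (μ : ℂ) • T ξ + T η) ∈ D.graph := by
  rw [hU.generator] at h ⊢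
  have hUT (t : ℝ) : U t (T ξ) = Complex.exp ((t * μ : ℝ) * Complex.I) • T (U t ξ) := by
    rw [hT, ← hU.map_add, neg_add_cancel, hU.map_zero]
  have hTU : HasDerivAt (fun t => T (U t ξ)) (T (Complex.I • η)) 0 :=
    ((T.restrictScalars ℝ).hasFDerivAt).comp_hasDerivAt (0 : ℝ) h
  have hprod := (hasDerivAt_exp_ofReal_mul_I μ).smul hTU
  simp_rw [hUT]
  refine hprod.congr_deriv (Eq.symm ?_)
  rw [hU.map_zero, map_smul, smul_add, smul_smul, mul_comm, add_comm]
  simp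

theorem le_of_isBoundedBelow (hU : IsUnitaryGroupGeneratedBy U D)
    {c : ℝ} (hc : ∀ ξ : D.domain, c * ‖(ξ : H)‖ ^ 2 ≤ (inner ℂ (ξ : H) (D ξ)).re)
    {T : H →L[ℂ] H} (hTnorm : ∀ ζ, ‖T ζ‖ ≤ ‖ζ‖) {μ : ℝ}
    (hT : ∀ t ξ, Complex.exp ((t * μ : ℝ) * Complex.I) • T ξ = U t (T (U (-t) ξ))) {ξ η : H}
    (h : (ξ, η) ∈ D.graph) : (c - μ) * ‖T ξ‖ ^ 2 ≤ ‖ξ‖ * ‖η‖ := by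
  obtain ⟨z, hz, hDz⟩ := (LinearPMap.mem_graph_iff _).1 (hU.apply_mem_graph hT h)
  have hinner : (inner ℂ (T ξ) (T η)).re ≤ ‖ξ‖ * ‖η‖ :=
    (Complex.re_le_norm _).trans ((norm_inner_le_norm _ _).trans
      (mul_le_mul (hTnorm _) (hTnorm _) (norm_nonneg _) (norm_nonneg _)))
  have hle : c * ‖T ξ‖ ^ 2 ≤ μ * ‖T ξ‖ ^ 2 + (inner ℂ (T ξ) (T η)).re := by
    have := hc z
    simp only at hz hDz
    rw [hDz, hz, inner_add_right, inner_smul_right, Complex.add_re, Complex.re_ofReal_mul] at this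
    exact this.trans_eq (by rw [← inner_self_eq_norm_sq (𝕜 := ℂ)]; rfl)
  linarith

variable [CompleteSpace H]

theorem apply_integral (hU : IsUnitaryGroupGeneratedBy U D) (ξ : H) (s t : ℝ) :
    U t (∫ r in (0 : ℝ)..s, U r ξ) =
      (∫ r in (0 : ℝ)..(s + t), U r ξ) - ∫ r in (0 : ℝ)..t, U r ξ := by
  have hint (a b : ℝ) : IntervalIntegrable (fun r => U r ξ) MeasureTheory.volume a b :=
    (hU.continuous ξ).intervalIntegrable a b
  calc U t (∫ r in (0 : ℝ)..s, U r ξ) = ∫ r in (0 : ℝ)..s, U t (U r ξ) :=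
        ((U t).toContinuousLinearEquiv.toContinuousLinearMap.intervalIntegral_comp_comm
          (hint 0 s)).symm
    _ = ∫ r in t..(s + t), U r ξ := by
        simp_rw [← hU.map_add]
        rw [intervalIntegral.integral_comp_add_left (fun r => U r ξ) t, add_zero, add_comm t s]
    _ = _ := (intervalIntegral.integral_interval_sub_left (hint _ _) (hint _ _)).symm

theorem hasDerivAt_integral (hU : IsUnitaryGroupGeneratedBy U D) (ξ : H) (s : ℝ) :
    HasDerivAt (fun s => ∫ r in (0 : ℝ)..s, U r ξ) (U s ξ) s :=
  ((hU.continuous ξ).integral_hasStrictDerivAt 0 s).hasDerivAt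

theorem integral_mem_domain (hU : IsUnitaryGroupGeneratedBy U D) (ξ : H) (s : ℝ) :
    (∫ r in (0 : ℝ)..s, U r ξ) ∈ D.domain := by
  have hderiv : HasDerivAt (fun t => U t (∫ r in (0 : ℝ)..s, U r ξ)) (U s ξ - ξ) 0 := by
    simp_rw [hU.apply_integral]
    have hs : HasDerivAt (fun t => ∫ r in (0 : ℝ)..(s + t), U r ξ) (U s ξ) 0 :=
      HasDerivAt.comp_const_add s 0 (by simpa only [add_zero] using hU.hasDerivAt_integral ξ s)
    have h0 : HasDerivAt (fun t => ∫ r in (0 : ℝ)..t, U r ξ) ξ 0 := by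
      simpa only [hU.map_zero] using hU.hasDerivAt_integral ξ 0
    exact hs.sub h0
  have hgraph : (∫ r in (0 : ℝ)..s, U r ξ, -Complex.I • (U s ξ - ξ)) ∈ D.graph := by
    rw [hU.generator, smul_smul]
    simpa using hderiv
  exact LinearPMap.mem_domain_of_mem_graph hgraph

theorem dense_domain (hU : IsUnitaryGroupGeneratedBy U D) : Dense (D.domain : Set H) := by
  intro ξ
  have hlim : Tendsto (fun s : ℝ => (s⁻¹ : ℝ) • ∫ r in (0 : ℝ)..s, U r ξ) (𝓝[≠] 0) (𝓝 ξ) := by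
    simpa [hU.map_zero] using hasDerivAt_iff_tendsto_slope_zero.1 (hU.hasDerivAt_integral ξ 0)
  refine mem_closure_of_tendsto hlim (Eventually.of_forall fun s => ?_)
  rw [← Complex.coe_smul]
  exact D.domain.smul_mem _ (hU.integral_mem_domain ξ s)

end IsUnitaryGroupGeneratedBy

namespace Place

section Completion

variable {K : Type*} [Field K] (A : ValuationSubring K)

/-- The embedding of `K` in its completion at `A`: the map `Place.embedding (finite A hA)`, with
the completion written in the form to which the library of valued fields applies. -/
noncomputable def completionEmbedding : K →+* A.valuation.Completion :=
  UniformSpace.Completion.coeRingHom.comp (WithVal.equiv A.valuation).symm.toRingHom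

theorem valued_completionEmbedding (x : K) :
    Valued.v (completionEmbedding A x) = A.valuation x :=
  Valued.valuedCompletion_apply _

theorem exists_valued_eq_valuation (x : A.valuation.Completion) :
    ∃ b : K, Valued.v x = A.valuation b := by
  obtain ⟨r, hr⟩ := Valued.exists_coe_eq_v (K := WithVal A.valuation) x
  exact ⟨WithVal.equiv A.valuation r, hr⟩

theorem denseRange_completionEmbedding : DenseRange (completionEmbedding A) :=
  UniformSpace.Completion.denseRange_coe.comp (WithVal.equiv A.valuation).symm.surjective.denseRange
    (UniformSpace.Completion.continuous_coe _)

variable {A}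

theorem isOpen_valued_le {u : K} (hu : u ≠ 0) :
    IsOpen {x : A.valuation.Completion | Valued.v x ≤ A.valuation u} := by
  have hu' : Valued.v.restrict (completionEmbedding A u) ≠ 0 := by
    rwa [Ne, Valuation.restrict_eq_zero_iff, valued_completionEmbedding, Valuation.zero_iff]
  simpa only [Valuation.restrict_le_iff, valued_completionEmbedding] using
    Valued.isOpen_closedBall A.valuation.Completion hu'

theorem exists_ne_zero_valuation_lt (hA : A ≠ ⊤) {b : K} (hb : b ≠ 0) :
    ∃ u : A, u ≠ 0 ∧ A.valuation u < A.valuation b := by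
  obtain ⟨π, hπ, hπ0⟩ := exists_mem_nonunits_ne_zero hA
  have hπ1 : A.valuation π < 1 := (A.mem_nonunits_iff).1 hπ
  by_cases hbA : b ∈ A
  · refine ⟨⟨b * π, A.mul_mem _ _ hbA (A.nonunits_subset hπ)⟩,
      fun h => mul_ne_zero hb hπ0 (congrArg Subtype.val h), ?_⟩
    rw [map_mul]
    exact mul_lt_of_lt_one_right (zero_lt_iff.2 ((Valuation.ne_zero_iff _).2 hb)) hπ1
  · refine ⟨⟨π, A.nonunits_subset hπ⟩, fun h => hπ0 (congrArg Subtype.val h), hπ1.trans ?_⟩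
    rwa [← not_le, A.valuation_le_one_iff]

theorem exists_valued_le_subset (hA : A ≠ ⊤) {s : Set A.valuation.Completion} (hs : s ∈ 𝓝 0) :
    ∃ u : A, u ≠ 0 ∧ {x | Valued.v x ≤ A.valuation u} ⊆ s := by
  obtain ⟨γ, hγ⟩ := Valued.mem_nhds_zero.1 hs
  obtain ⟨z, hz⟩ := MonoidWithZeroHom.ValueGroup₀.restrict₀_surjective
    (.ofClass (Valued.v : Valuation A.valuation.Completion A.ValueGroup)) γ.1
  have hz0 : z ≠ 0 := fun h => γ.ne_zero (by rw [← hz, h, map_zero])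
  obtain ⟨b, hb⟩ := exists_valued_eq_valuation A z
  have hb0 : b ≠ 0 := by
    rwa [← Valuation.ne_zero_iff A.valuation, ← hb, Valuation.ne_zero_iff]
  obtain ⟨u, hu, hub⟩ := exists_ne_zero_valuation_lt hA hb0
  refine ⟨u, hu, fun x hx => hγ ?_⟩
  rw [Set.mem_ofPred_eq, ← hz, ← Valuation.restrict_def, Valuation.restrict_lt_iff, hb]
  exact lt_of_le_of_lt hx hub

theorem exists_valued_sub_le {x : A.valuation.Completion} (hx : Valued.v x ≤ 1) {u : A}
    (hu : u ≠ 0) : ∃ a : A, Valued.v (x - completionEmbedding A a) ≤ A.valuation u := by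
  have hball : {z : A.valuation.Completion | Valued.v (x - z) ≤ A.valuation u} ∈ 𝓝 x :=
    ((isOpen_valued_le (by simpa using hu)).preimage (continuous_sub_left x)).mem_nhds
      (by simp)
  obtain ⟨a, ha⟩ := (denseRange_completionEmbedding A).mem_nhds hball
  refine ⟨⟨a, ?_⟩, ha⟩
  rw [← A.valuation_le_one_iff, ← valued_completionEmbedding,
    ← sub_sub_cancel x (completionEmbedding A a)]
  exact (Valuation.map_sub _ _ _).trans (max_le hx (le_trans ha (A.valuation_le_one u)))

theorem valuation_sub_le_of_mk_eq {a b u : A}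
    (h : Ideal.Quotient.mk (Ideal.span {u}) a = Ideal.Quotient.mk _ b) :
    A.valuation (a - b) ≤ A.valuation u := by
  obtain ⟨r, hr⟩ := Ideal.mem_span_singleton'.1 (Ideal.Quotient.eq.1 h)
  have hab : (a - b : K) = r * u := (congrArg Subtype.val hr).symm
  rw [hab, map_mul]
  exact mul_le_of_le_one_left' (A.valuation_le_one r)

theorem isCompact_valued_le_one [Ring.HasFiniteQuotients A] (hA : A ≠ ⊤) :
    IsCompact {x : A.valuation.Completion | Valued.v x ≤ 1} := by
  rw [isCompact_iff_totallyBounded_isComplete]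
  refine ⟨?_, (Valued.isClosed_integer A.valuation.Completion).isComplete⟩
  rw [totallyBounded_iff_subset_finite_iUnion_nhds_zero]
  intro U hU
  obtain ⟨u, hu, huU⟩ := exists_valued_le_subset hA hU
  have : Finite (A ⧸ Ideal.span {u}) :=
    Ring.HasFiniteQuotients.finiteQuotient (mt Ideal.span_singleton_eq_bot.1 hu)
  let φ (q : A ⧸ Ideal.span {u}) : A.valuation.Completion := completionEmbedding A (q.out : A)
  refine ⟨Set.range φ, Set.finite_range φ, fun x hx => ?_⟩
  obtain ⟨a, ha⟩ := exists_valued_sub_le hx hu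
  have hφ : Valued.v (completionEmbedding A a - φ (Ideal.Quotient.mk _ a)) ≤ A.valuation u := by
    rw [← map_sub, valued_completionEmbedding]
    exact valuation_sub_le_of_mk_eq (Quotient.out_eq _).symm
  refine Set.mem_iUnion₂.2 ⟨φ (Ideal.Quotient.mk _ a), ⟨_, rfl⟩, ?_⟩
  rw [Set.mem_vadd_set_iff_neg_vadd_mem, vadd_eq_add, neg_add_eq_sub]
  refine huU ?_
  rw [Set.mem_ofPred_eq, ← sub_add_sub_cancel x (completionEmbedding A a)]
  exact (Valuation.map_add _ _ _).trans (max_le ha hφ)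

end Completion

section Topology

variable {K : Type*} [Field K]

instance : (w : Place K) → IsTopologicalRing w.Completion
  | infinite v => inferInstanceAs (IsTopologicalRing v.Completion)
  | finite A _ => inferInstanceAs (IsTopologicalRing A.valuation.Completion)

instance : (w : Place K) → T2Space w.Completion
  | infinite v => inferInstanceAs (T2Space v.Completion)
  | finite A _ => inferInstanceAs (T2Space A.valuation.Completion)

theorem isOpen_integers : (w : Place K) → IsOpen (w.integers : Set w.Completion)
  | infinite _ => isOpen_univ
  | finite A _ => Valued.isOpen_integer A.valuation.Completion

theorem interior_closedUnitBall_finite (A : ValuationSubring K) (hA : A ≠ ⊤) :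
    interior (finite A hA).closedUnitBall = (finite A hA).integers :=
  (Valued.isOpen_integer A.valuation.Completion).interior_eq

variable [IsGlobalField K]

instance : (w : Place K) → LocallyCompactSpace w.Completion
  | infinite v => inferInstanceAs (LocallyCompactSpace v.Completion)
  | finite A hA =>
    IsCompact.locallyCompactSpace_of_mem_nhds_of_addGroup (G := A.valuation.Completion)
      (isCompact_valued_le_one hA)
      ((Valued.isOpen_integer A.valuation.Completion).mem_nhds (zero_mem (Valued.v.integer)))

variable (K) in
theorem finite_infinitePlace : Finite (NumberField.InfinitePlace K) := by
  rcases IsGlobalField.numberField_or_functionField (K := K) with h | ⟨p, hp, _, _⟩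
  · infer_instance
  · have := isEmpty_infinitePlace_of_algebra_ratFunc K p
    infer_instance

variable (K) in
theorem eventually_exists_finite :
    ∀ᶠ w : Place K in cofinite, ∃ A hA, w = finite A hA := by
  have := finite_infinitePlace K
  refine (Set.finite_range (infinite (K := K))).subset fun w hw => ?_
  rcases w with w | ⟨A, hA⟩
  · exact ⟨w, rfl⟩
  · exact absurd ⟨A, hA, rfl⟩ hw

end Topology

end Place

namespace AdeleRing

variable {K : Type*} [Field K]

theorem isOpen_forall_mem {U : (w : Place K) → Set w.Completion} (hU : ∀ w, IsOpen (U w))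
    (hUint : ∀ᶠ w in cofinite, U w = w.integers) :
    IsOpen {a : AdeleRing K | ∀ w, a w ∈ U w} := by
  have hint := RestrictedProduct.isOpen_forall_imp_mem (Place.isOpen_integers (K := K))
    (p := fun w => U w = w.integers)
  have hexc : IsOpen (⋂ w ∈ {w | ¬ U w = w.integers}, {a : AdeleRing K | a w ∈ U w}) :=
    hUint.isOpen_biInter fun w _ => (hU w).preimage (RestrictedProduct.continuous_eval w)
  convert! hint.inter hexc using 1
  ext a
  simp only [Set.mem_inter_iff, Set.mem_ofPred_eq, Set.mem_iInter]
  refine ⟨fun h => ⟨fun w hw => hw ▸ h w, fun w _ => h w⟩, fun h w => ?_⟩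
  by_cases hw : U w = w.integers
  · rw [hw]
    exact h.1 w hw
  · exact h.2 w hw

variable [IsGlobalField K]

theorem smul_apply (k : Kˣ) (a : AdeleRing K) (w : Place K) :
    (k • a) w = w.embedding k * a w := rfl

instance : T2Space (AdeleRing K) :=
  T2Space.of_injective_continuous (f := fun (a : AdeleRing K) (w : Place K) => a w)
    DFunLike.coe_injective RestrictedProduct.continuous_coe

instance : LocallyCompactSpace (AdeleRing K) := by
  have : WeaklyLocallyCompactSpace (AdeleRing K) := by
    refine RestrictedProduct.weaklyLocallyCompactSpace_of_cofinite Place.isOpen_integers ?_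
    filter_upwards [Place.eventually_exists_finite K] with w hw
    obtain ⟨A, hA, rfl⟩ := hw
    exact Place.isCompact_valued_le_one hA
  infer_instance

theorem isOpen_forall_mem_interior (k : Kˣ) :
    IsOpen {a : AdeleRing K | ∀ w, a w ∈ interior w.closedUnitBall ∧
      w.embedding (k : K) * a w ∈ interior w.closedUnitBall} := by
  refine isOpen_forall_mem (U := fun w => {z | z ∈ interior w.closedUnitBall ∧
    w.embedding (k : K) * z ∈ interior w.closedUnitBall}) (fun w => ?_) ?_
  · exact isOpen_interior.inter (isOpen_interior.preimage (continuous_const.mul continuous_id))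
  · filter_upwards [Place.eventually_exists_finite K,
      Place.eventually_embedding_mem_integers (k : K)] with w hw hk
    obtain ⟨A, hA, rfl⟩ := hw
    simp only [Place.interior_closedUnitBall_finite]
    ext z
    exact ⟨fun h => h.1, fun h => ⟨h, mul_mem hk h⟩⟩

end AdeleRing

namespace ValuationGroupoid

variable {K : Type*} [Field K] [IsGlobalField K] {v : Place K}

theorem continuous_x : Continuous fun γ : ValuationGroupoid v => γ.x :=
  let : TopologicalSpace Kˣ := ⊥
  continuous_snd.comp (continuous_induced_dom (f := fun γ : ValuationGroupoid v => (γ.k, γ.x)))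

theorem isCompact_setOf_k_eq_and_x_mem {k : Kˣ} {S : Set (AdeleRing K)} (hS : IsCompact S)
    (hSk : ∀ a ∈ S, ∀ w : Place K, a w ∈ interior w.closedUnitBall ∧
      w.embedding (k : K) * a w ∈ interior w.closedUnitBall) :
    IsCompact {γ : ValuationGroupoid v | γ.k = k ∧ γ.x ∈ S} := by
  let : TopologicalSpace Kˣ := ⊥
  have hind : IsInducing fun γ : ValuationGroupoid v => (γ.k, γ.x) := ⟨rfl⟩
  have himage : (fun γ : ValuationGroupoid v => (γ.k, γ.x)) '' {γ | γ.k = k ∧ γ.x ∈ S} =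
      {k} ×ˢ (S ∩ {a : AdeleRing K | a v = 0}) := by
    ext ⟨l, a⟩
    constructor
    · rintro ⟨γ, ⟨hk, hx⟩, rfl, rfl⟩
      exact ⟨hk, hx, γ.source_mem.1⟩
    · rintro ⟨rfl, haS, hav : a v = 0⟩
      refine ⟨⟨l, a, ⟨hav, fun w => (hSk a haS w).1⟩, ?_, fun w => (hSk a haS w).2⟩,
        ⟨rfl, haS⟩, rfl⟩
      rw [AdeleRing.smul_apply, hav, mul_zero]
  rw [hind.isCompact_iff, himage]
  exact isCompact_singleton.prod
    (hS.inter_right (isClosed_singleton.preimage (RestrictedProduct.continuous_eval v)))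

theorem exists_bump (γ₀ : ValuationGroupoid v) :
    ∃ f : CompactlySupportedContinuousMap (ValuationGroupoid v) ℂ,
      f γ₀ = 1 ∧ (∀ γ, ‖f γ‖ ≤ 1) ∧ ∀ γ, f γ ≠ 0 → γ.k = γ₀.k := by
  classical
  obtain ⟨φ, hφ1, hφc, hφs, hφ⟩ := exists_continuousMap_one_of_isCompact_subset_isOpen
    (isCompact_singleton (x := γ₀.x)) (AdeleRing.isOpen_forall_mem_interior γ₀.k)
    (by
      rintro _ rfl w
      exact ⟨γ₀.source_mem.2 w, γ₀.range_mem.2 w⟩)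
  let g (γ : ValuationGroupoid v) : ℂ := (if γ.k = γ₀.k then 1 else 0) * (φ γ.x : ℂ)
  have hg : Continuous g := (continuous_of_k fun k => if k = γ₀.k then (1 : ℂ) else 0).mul
    (Complex.continuous_ofReal.comp (φ.continuous.comp continuous_x))
  have hgk (γ) (h : g γ ≠ 0) : γ.k = γ₀.k := by
    by_contra hne
    exact h (by simp [g, hne])
  have hclosed : IsClosed {γ : ValuationGroupoid v | γ.k = γ₀.k ∧ γ.x ∈ tsupport φ} :=
    let : TopologicalSpace Kˣ := ⊥
    have : DiscreteTopology Kˣ := ⟨rfl⟩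
    (isClosed_singleton.preimage (continuous_of_k fun k => k)).inter
      ((isClosed_tsupport φ).preimage continuous_x)
  have hsupport : HasCompactSupport g := by
    refine .intro' (isCompact_setOf_k_eq_and_x_mem hφc fun a ha => hφs ha) hclosed fun γ hγ => ?_
    by_contra hne
    refine hγ ⟨hgk γ hne, subset_tsupport _ fun h0 => hne ?_⟩
    simp only [g, h0, Complex.ofReal_zero, mul_zero]
  refine ⟨⟨⟨g, hg⟩, hsupport⟩, ?_, fun γ => ?_, hgk⟩
  · change (if γ₀.k = γ₀.k then (1 : ℂ) else 0) * (φ γ₀.x : ℂ) = 1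
    simp [hφ1 rfl]
  · change ‖(if γ.k = γ₀.k then (1 : ℂ) else 0) * (φ γ.x : ℂ)‖ ≤ 1
    have := hφ γ.x
    split_ifs
    · simpa [abs_of_nonneg this.1] using this.2
    · simp

end ValuationGroupoid

theorem sum_norm_le_of_support_subsingleton {ι E : Type*} [SeminormedAddCommGroup E] {f : ι → E}
    {C : ℝ} (hC : 0 ≤ C) (hf : ∀ i, ‖f i‖ ≤ C) (hsupp : f.support.Subsingleton) (s : Finset ι) :
    ∑ i ∈ s, ‖f i‖ ≤ C := by
  by_cases h : ∃ i ∈ s, f i ≠ 0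
  · obtain ⟨i, his, hi⟩ := h
    rw [Finset.sum_eq_single_of_mem i his fun j _ hji => ?_]
    · exact hf i
    · by_contra hj
      exact hji (hsupp (fun h => hj (by rw [h, norm_zero])) hi)
  · push Not at h
    rw [Finset.sum_eq_zero fun i hi => by rw [h i hi, norm_zero]]
    exact hC

section RegularRep

variable {K : Type*} [Field K] [IsGlobalField K] {v : Place K} {y : unitSpace v}

namespace ValuationGroupoid.Fiber

theorem ext_k {γ γ' : Fiber y} (h : γ.1.k = γ'.1.k) : γ = γ' :=
  Subtype.ext (ValuationGroupoid.ext h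
    ((congrArg Subtype.val γ.2).trans (congrArg Subtype.val γ'.2).symm))

variable (y) in
/-- The unit `(1, y)` of the groupoid at `y`. -/
def one : Fiber y :=
  ⟨⟨1, y.1, y.2, by rw [one_smul]; exact y.2⟩, rfl⟩

theorem div_one (γ : Fiber y) : γ.div (one y) = γ.1 := by
  refine ValuationGroupoid.ext ?_ ?_
  · change γ.1.k * (1 : Kˣ)⁻¹ = γ.1.k
    rw [inv_one, mul_one]
  · change (1 : Kˣ) • y.1 = γ.1.x
    rw [one_smul]
    exact (congrArg Subtype.val γ.2).symm

theorem eq_of_k_div_left_eq {γ γ₁ γ₂ : Fiber y} (h : (γ.div γ₁).k = (γ.div γ₂).k) : γ₁ = γ₂ :=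
  ext_k (inv_injective (mul_left_cancel h))

theorem eq_of_k_div_right_eq {γ γ₁ γ₂ : Fiber y} (h : (γ₁.div γ).k = (γ₂.div γ).k) : γ₁ = γ₂ :=
  ext_k (mul_right_cancel h)

end ValuationGroupoid.Fiber

variable {f : CompactlySupportedContinuousMap (ValuationGroupoid v) ℂ}

theorem regularRep_apply (f : CompactlySupportedContinuousMap (ValuationGroupoid v) ℂ)
    (ξ : lp (fun _ : Fiber y => ℂ) 2) (γ : Fiber y) :
    regularRep y f ξ γ = ∑' γ₂ : Fiber y, f (γ.div γ₂) * ξ γ₂ := rfl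

theorem norm_regularRep_le {k : Kˣ} (hf : ∀ γ, ‖f γ‖ ≤ 1) (hk : ∀ γ, f γ ≠ 0 → γ.k = k)
    (ξ : lp (fun _ : Fiber y => ℂ) 2) : ‖regularRep y f ξ‖ ≤ ‖ξ‖ := by
  obtain ⟨-, -, -, hfin⟩ := exists_schur_bound y f
  refine lp.norm_le_of_forall_sum_le (by simp) (norm_nonneg _) fun s => ?_
  have hschur := schur_bound (a := fun γ γ₂ : Fiber y => f (γ.div γ₂)) (M := 1)
    (fun γ => sum_norm_le_of_support_subsingleton zero_le_one (fun _ => hf _)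
      fun _ h₁ _ h₂ => Fiber.eq_of_k_div_left_eq ((hk _ h₁).trans (hk _ h₂).symm))
    (fun γ => sum_norm_le_of_support_subsingleton zero_le_one (fun _ => hf _)
      fun _ h₁ _ h₂ => Fiber.eq_of_k_div_right_eq ((hk _ h₁).trans (hk _ h₂).symm)) hfin ξ s
  simpa [regularRep_apply] using hschur

theorem regularRep_apply_of_support {γ₀ : Fiber y} (hf1 : f γ₀.1 = 1)
    (hk : ∀ γ, f γ ≠ 0 → γ.k = γ₀.1.k) (ξ : lp (fun _ : Fiber y => ℂ) 2) :
    regularRep y f ξ γ₀ = ξ (Fiber.one y) := by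
  rw [regularRep_apply, tsum_eq_single (Fiber.one y), Fiber.div_one, hf1, one_mul]
  intro γ₂ hγ₂
  refine mul_eq_zero_of_left (not_not.1 fun h => hγ₂ ?_) _
  refine Fiber.eq_of_k_div_left_eq (γ := γ₀) ?_
  rw [hk _ h, Fiber.div_one]

theorem regularRep_timeEvolution {k : Kˣ} (hk : ∀ γ, f γ ≠ 0 → γ.k = k) (t : ℝ)
    (ξ : lp (fun _ : Fiber y => ℂ) 2) :
    regularRep y (timeEvolution v t f) ξ =
      Complex.exp ((t * Real.log (v.absValue k) : ℝ) * Complex.I) • regularRep y f ξ := by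
  ext γ
  rw [lp.coeFn_smul, Pi.smul_apply, regularRep_apply, regularRep_apply, smul_eq_mul,
    ← tsum_mul_left]
  refine tsum_congr fun γ₂ => ?_
  change ((v.absValue (γ.div γ₂).k : ℝ) : ℂ) ^ (Complex.I * t) * f (γ.div γ₂) * ξ γ₂ = _
  by_cases h : f (γ.div γ₂) = 0
  · simp [h]
  · rw [hk _ h, v.cpow_absValue, mul_assoc]

end RegularRep

theorem IsUnitaryGroupGeneratedBy.exists_mem_graph_half_le {I : Type*}
    {U : ℝ → lp (fun _ : I => ℂ) 2 ≃ₗᵢ[ℂ] lp (fun _ : I => ℂ) 2}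
    {D : lp (fun _ : I => ℂ) 2 →ₗ.[ℂ] lp (fun _ : I => ℂ) 2}
    (hU : IsUnitaryGroupGeneratedBy U D) (i : I) :
    ∃ ξ η, (ξ, η) ∈ D.graph ∧ 1 / 2 ≤ ‖ξ i‖ := by
  classical
  let δ : lp (fun _ : I => ℂ) 2 := lp.single 2 i (1 : ℂ)
  have hδ : δ i = 1 := lp.single_apply_self (E := fun _ : I => ℂ) 2 i 1
  obtain ⟨ξ, hξ, hdist⟩ := hU.dense_domain.exists_dist_lt δ (ε := 1 / 2) (by norm_num)
  refine ⟨ξ, D ⟨ξ, hξ⟩, (LinearPMap.mem_graph_iff _).2 ⟨⟨ξ, hξ⟩, rfl, rfl⟩, ?_⟩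
  rw [dist_eq_norm] at hdist
  have hclose : ‖δ i - ξ i‖ ≤ 1 / 2 :=
    (lp.norm_apply_le_norm two_ne_zero (δ - ξ) i).trans hdist.le
  have htri := norm_sub_norm_le (δ i) (ξ i)
  rw [hδ, norm_one] at htri
  rw [hδ] at hclose
  linarith

/-- Convolution with a bump function at `(k, y)` shifts every Hamiltonian implementing the time
evolution by `log |k|_v`, while keeping a vector with a large component at `(1, y)` away from `0`;
so a very negative `log |k|_v` contradicts the lower bound of the Hamiltonian. -/
theorem exists_le_energy_of_isPositiveEnergy {K : Type*} [Field K] [IsGlobalField K]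
    {v : Place K} {y : unitSpace v} (hpos : IsPositiveEnergy (regularRep y) (timeEvolution v)) :
    ∃ c : ℝ, ∀ γ, c ≤ energy y γ := by
  obtain ⟨D, ⟨U, hU, himp⟩, c, hc⟩ := hpos
  obtain ⟨ξ, η, hgraph, hξ⟩ := hU.exists_mem_graph_half_le (Fiber.one y)
  refine ⟨c - 4 * (‖ξ‖ * ‖η‖), fun γ₀ => ?_⟩
  obtain ⟨f, hf1, hf, hk⟩ := γ₀.1.exists_bump
  have hbound := hU.le_of_isBoundedBelow hc (T := regularRep y f) (norm_regularRep_le hf hk)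
    (μ := energy y γ₀) (fun t ζ => by
      rw [← himp]
      exact (regularRep_timeEvolution hk t ζ).symm) hgraph
  have hT : 1 / 2 ≤ ‖regularRep y f ξ‖ := by
    refine hξ.trans ?_
    rw [← regularRep_apply_of_support hf1 hk ξ]
    exact lp.norm_apply_le_norm two_ne_zero (regularRep y f ξ) γ₀
  by_contra! hlt
  have hprod : 0 ≤ ‖ξ‖ * ‖η‖ := by positivity
  have hT2 : 1 / 4 ≤ ‖regularRep y f ξ‖ ^ 2 := by nlinarith
  nlinarith

section ClassicalOrbit

variable {K : Type*} [Field K]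

theorem AdeleRing.isUnit_iff {a : AdeleRing K} :
    IsUnit a ↔ (∀ w, a w ≠ 0) ∧ ∀ᶠ w in cofinite, (a w)⁻¹ ∈ w.integers := by
  constructor
  · rintro ⟨j, rfl⟩
    have hj (w : Place K) : (j : AdeleRing K) w * (↑j⁻¹ : AdeleRing K) w = 1 :=
      congrArg (fun b : AdeleRing K => b w) j.mul_inv
    refine ⟨fun w => left_ne_zero_of_mul_eq_one (hj w), ?_⟩
    filter_upwards [(↑j⁻¹ : AdeleRing K).2] with w hw
    rwa [inv_eq_of_mul_eq_one_right (hj w)]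
  · rintro ⟨ha, hinv⟩
    refine IsUnit.of_mul_eq_one (RestrictedProduct.mk (fun w => (a w)⁻¹) hinv) ?_
    ext w
    exact mul_inv_cancel₀ (ha w)

theorem mul_basePoint_apply_self {v : Place K} (a : AdeleRing K) : (a * basePoint v) v = 0 := by
  classical
  change a v * (if v = v then 0 else 1) = 0
  rw [if_pos rfl, mul_zero]

theorem mul_basePoint_apply_of_ne {v w : Place K} (a : AdeleRing K) (hw : w ≠ v) :
    (a * basePoint v) w = a w := by
  classical
  change a w * (if w = v then 0 else 1) = a w
  rw [if_neg hw, mul_one]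

variable [IsGlobalField K] {v : Place K}

theorem adeleClass_mem_classicalOrbit_iff_exists_units {y : AdeleRing K} :
    adeleClass y ∈ classicalOrbit v ↔ ∃ j : (AdeleRing K)ˣ, j * basePoint v = y := by
  constructor
  · rintro ⟨c, hc⟩
    induction c using Quotient.inductionOn' with
    | h j =>
    have hc : adeleClass ((j : AdeleRing K) * basePoint v) = adeleClass y := hc
    obtain ⟨k, rfl⟩ := Quotient.exact hc.symm
    refine ⟨Units.map (algebraMap K (AdeleRing K) : K →* AdeleRing K) k * j, ?_⟩
    rw [Units.val_mul, mul_assoc]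
    exact (Algebra.smul_def (k : K) _).symm
  · rintro ⟨j, rfl⟩
    exact ⟨(j : IdeleClassGroup K), rfl⟩

/-- The component at `v` satisfies the second condition because `0⁻¹ = 0`. -/
theorem adeleClass_mem_classicalOrbit_iff {y : AdeleRing K} (hy : y v = 0) :
    adeleClass y ∈ classicalOrbit v ↔
      (∀ w, w ≠ v → y w ≠ 0) ∧ ∀ᶠ w in cofinite, (y w)⁻¹ ∈ w.integers := by
  classical
  rw [adeleClass_mem_classicalOrbit_iff_exists_units]
  constructor
  · rintro ⟨j, rfl⟩
    obtain ⟨hj, hinv⟩ := AdeleRing.isUnit_iff.1 j.isUnit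
    refine ⟨fun w hw => by rw [mul_basePoint_apply_of_ne _ hw]; exact hj w, ?_⟩
    filter_upwards [hinv] with w hjw
    by_cases hw : w = v
    · subst hw
      rw [mul_basePoint_apply_self, inv_zero]
      exact zero_mem _
    · rwa [mul_basePoint_apply_of_ne _ hw]
  · rintro ⟨hy0, hinv⟩
    have hmem (w) (z : w.Completion) (hz : z ∈ w.integers) :
        (if w = v then 1 else z) ∈ w.integers := by
      split_ifs
      exacts [one_mem _, hz]
    let a : AdeleRing K := RestrictedProduct.mk (fun w => if w = v then 1 else y w)
      (y.2.mono fun w hw => hmem w _ hw)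
    have ha (w) : a w = if w = v then 1 else y w := rfl
    have hunit : IsUnit a := by
      refine AdeleRing.isUnit_iff.2 ⟨fun w => ?_, hinv.mono fun w hw => ?_⟩
      · rw [ha]
        split_ifs with h
        exacts [one_ne_zero, hy0 w h]
      · rw [ha, apply_ite (·⁻¹), inv_one]
        exact hmem w _ hw
    refine ⟨hunit.unit, ?_⟩
    ext w
    by_cases hw : w = v
    · subst hw
      rw [mul_basePoint_apply_self, hy]
    · rw [mul_basePoint_apply_of_ne _ hw, hunit.unit_spec, ha, if_neg hw]

end ClassicalOrbit

section BoundedIntegral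

variable {K : Type*} [Field K]

theorem isIntegral_int_of_forall_mem {x : K} (hx : ∀ A : ValuationSubring K, A ≠ ⊤ → x ∈ A) :
    IsIntegral ℤ x := by
  let R : Subring K := Subring.closure ∅
  have hxR : x ∈ (integralClosure R K).toSubring := by
    rw [← iInf_valuationSubring_superset (K := K) (s := ∅)]
    simp only [Subring.mem_iInf]
    rintro ⟨A, -⟩
    by_cases hA : A = ⊤
    · subst hA
      exact Subring.mem_top x
    · exact hx A hA
  have : Algebra.IsIntegral ℤ R := by
    refine ⟨fun ⟨z, hz⟩ => ?_⟩
    have hz' : z ∈ (⊥ : Subring K) := by rwa [← Subring.closure_empty]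
    obtain ⟨n, rfl⟩ := Subring.mem_bot.1 hz'
    exact isIntegral_algebraMap (A := R) (x := n)
  exact isIntegral_trans x hxR

theorem eq_zero_of_isIntegral_of_mem_nonunits {p : ℕ} [Fact p.Prime] [Algebra (ZMod p) K] {x : K}
    (hx : IsIntegral ℤ x) {A : ValuationSubring K} (hxA : x ∈ A.nonunits) : x = 0 := by
  have : Algebra.IsIntegral ℤ (ZMod p) :=
    ⟨fun c => ZMod.intCast_zmod_cast c ▸ isIntegral_algebraMap (x := (c.cast : ℤ))⟩
  have hinv : IsIntegral ℤ x⁻¹ := isIntegral_trans (A := ZMod p) _ (hx.tower_top).inv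
  obtain ⟨a, ha⟩ := (IsIntegrallyClosed.isIntegral_iff (R := A) (K := K)).1 (hinv.tower_top)
  refine (A.inv_mem_nonunits_iff.1 ((inv_inv x).symm ▸ hxA)).elim inv_eq_zero.1 fun h => ?_
  exact absurd (ha ▸ a.2) h

theorem finite_bounded_integral [IsGlobalField K] (S : Set (ValuationSubring K))
    (hS : IsEmpty (NumberField.InfinitePlace K) → S.Nonempty)
    (B : NumberField.InfinitePlace K → ℝ) :
    {x : K | (∀ A : ValuationSubring K, A ≠ ⊤ → x ∈ A) ∧ (∀ A ∈ S, x ∈ A.nonunits) ∧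
      ∀ w : NumberField.InfinitePlace K, w x ≤ B w}.Finite := by
  rcases IsGlobalField.numberField_or_functionField (K := K) with h | ⟨p, hp, _, _⟩
  · obtain ⟨C, hC⟩ := (Set.finite_range B).bddAbove
    refine (NumberField.Embeddings.finite_of_norm_le K ℂ C).subset ?_
    rintro x ⟨hx, -, hw⟩
    refine ⟨isIntegral_int_of_forall_mem hx, fun φ => ?_⟩
    exact (hw (NumberField.InfinitePlace.mk φ)).trans (hC ⟨_, rfl⟩)
  · let : Algebra (ZMod p) K := Algebra.compHom K (algebraMap (ZMod p) (RatFunc (ZMod p)))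
    obtain ⟨A, hA⟩ := hS (isEmpty_infinitePlace_of_algebra_ratFunc K p)
    refine (Set.finite_singleton (0 : K)).subset ?_
    rintro x ⟨hx, hxS, -⟩
    exact eq_zero_of_isIntegral_of_mem_nonunits (p := p) (isIntegral_int_of_forall_mem hx)
      (hxS A hA)

theorem exists_colouring_sub_mem_nonunits {A : ValuationSubring K} [Ring.HasFiniteQuotients A]
    (hA : A ≠ ⊤) {b : A} (hb : b ≠ 0) : ∃ (n : ℕ) (colour : K → Fin n), ∀ k l : K,
      k * b ∈ A → l * b ∈ A → colour k = colour l → k - l ∈ A.nonunits := by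
  classical
  obtain ⟨c, hc, hc0⟩ := exists_mem_nonunits_ne_zero hA
  let I : Ideal A := Ideal.span {b * ⟨c, A.nonunits_subset hc⟩}
  have hI : I ≠ ⊥ := mt Ideal.span_singleton_eq_bot.1
    (mul_ne_zero hb fun h => hc0 (congrArg Subtype.val h))
  have : Finite (A ⧸ I) := Ring.HasFiniteQuotients.finiteQuotient hI
  let e := Finite.equivFin (A ⧸ I)
  refine ⟨_, fun k => e (if h : k * b ∈ A then Ideal.Quotient.mk I ⟨k * b, h⟩ else 0),
    fun k l hk hl hkl => ?_⟩
  simp only [dif_pos hk, dif_pos hl, e.apply_eq_iff_eq, Ideal.Quotient.eq] at hkl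
  obtain ⟨r, hr⟩ := Ideal.mem_span_singleton'.1 hkl
  have hr' : (r : K) * (b * c) = k * b - l * b := congrArg Subtype.val hr
  have hbK : (b : K) ≠ 0 := by simpa using hb
  have hkl' : k - l = c * r := mul_right_cancel₀ hbK (by rw [sub_mul, ← hr']; ring)
  rw [hkl', A.mem_nonunits_iff, map_mul]
  exact mul_lt_one_of_lt_of_le (A.mem_nonunits_iff.1 hc) (A.valuation_le_one r)

/-- By the pigeonhole principle it suffices to bound the elements with a given residue at each
place of `S`, and the differences of these are integral and lie in the maximal ideals of `S`. -/
theorem finite_of_bounded_at_places [IsGlobalField K] {M : Set K} {S : Set (ValuationSubring K)}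
    (hS : S.Finite) (hStop : ∀ A ∈ S, A ≠ ⊤)
    (hSne : IsEmpty (NumberField.InfinitePlace K) → S.Nonempty)
    (hnotMem : ∀ A : ValuationSubring K, A ≠ ⊤ → A ∉ S → ∀ k ∈ M, k ∈ A)
    (hmem : ∀ A ∈ S, ∃ b : A, b ≠ 0 ∧ ∀ k ∈ M, k * b ∈ A)
    (hinf : ∀ w : NumberField.InfinitePlace K, ∃ B : ℝ, ∀ k ∈ M, w k ≤ B) : M.Finite := by
  have : Finite S := hS
  choose B hB using hinf
  choose b hb0 hb using fun A : S => hmem A A.2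
  choose n colour hcolour using fun A : S =>
    exists_colouring_sub_mem_nonunits (hStop A A.2) (hb0 A)
  refine Set.Finite.of_finite_fibers (fun k A => colour A k) (Set.toFinite _) ?_
  rintro _ ⟨l, hl, rfl⟩
  refine ((finite_bounded_integral S hSne fun w => B w + B w).preimage
    (f := fun k => k - l) sub_left_injective.injOn).subset ?_
  rintro k ⟨hk, hkl⟩
  have hnonunit (A) (hA : A ∈ S) : k - l ∈ A.nonunits :=
    hcolour ⟨A, hA⟩ k l (hb _ k hk) (hb _ l hl) (congrFun (Set.mem_singleton_iff.1 hkl) ⟨A, hA⟩)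
  refine ⟨fun A hA => ?_, hnonunit, fun w => ?_⟩
  · by_cases hAS : A ∈ S
    · exact A.nonunits_subset (hnonunit A hAS)
    · exact sub_mem (hnotMem A hA hAS k hk) (hnotMem A hA hAS l hl)
  · exact (map_sub_le_add w.1 k l).trans (add_le_add (hB w k hk) (hB w l hl))

end BoundedIntegral

section BoundedMultipliers

variable {K : Type*} [Field K]

/-- The set of `k` with `|k|_v ≤ 1` that map `y` to the unit balls away from `v`. -/
def boundedMultipliers (v : Place K) (y : AdeleRing K) : Set K :=
  {k | v.absValue k ≤ 1 ∧ ∀ w, w ≠ v → w.embedding k * y w ∈ w.closedUnitBall}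

variable {v : Place K} {y : AdeleRing K}

theorem mem_of_mem_boundedMultipliers {A : ValuationSubring K} {hA : A ≠ ⊤}
    (hv : Place.finite A hA ≠ v) (hy0 : y (Place.finite A hA) ≠ 0)
    (hy : (y (Place.finite A hA))⁻¹ ∈ (Place.finite A hA).integers) {k : K}
    (hk : k ∈ boundedMultipliers v y) : k ∈ A := by
  let z : A.valuation.Completion := y (Place.finite A hA)
  have hz : z ≠ 0 := hy0
  have hkz : Valued.v (Place.completionEmbedding A k * z) ≤ 1 := hk.2 _ hv
  have hzinv : Valued.v z⁻¹ ≤ 1 := hy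
  rw [← A.valuation_le_one_iff, ← Place.valued_completionEmbedding,
    ← mul_inv_cancel_right₀ hz (Place.completionEmbedding A k), map_mul]
  exact mul_le_one' hkz hzinv

theorem norm_algebraMap_infinitePlace_completion (w : NumberField.InfinitePlace K) (k : K) :
    ‖algebraMap K w.Completion k‖ = w k :=
  NumberField.InfinitePlace.Completion.norm_coe w ((WithAbs.equiv w.1).symm k)

theorem exists_infinitePlace_le_of_mem_boundedMultipliers (hy0 : ∀ w, w ≠ v → y w ≠ 0)
    (w : NumberField.InfinitePlace K) : ∃ B : ℝ, ∀ k ∈ boundedMultipliers v y, w k ≤ B := by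
  by_cases hv : Place.infinite w = v
  · subst hv
    exact ⟨1, fun k hk => (pow_le_one_iff_of_nonneg (apply_nonneg w k) w.mult_ne_zero).1 hk.1⟩
  · let z : w.Completion := y (Place.infinite w)
    have hz : z ≠ 0 := hy0 _ hv
    refine ⟨‖z‖⁻¹, fun k hk => ?_⟩
    have hkz : ‖algebraMap K w.Completion k * z‖ ≤ 1 := hk.2 _ hv
    rw [norm_mul, norm_algebraMap_infinitePlace_completion] at hkz
    rwa [← one_div, le_div_iff₀ (norm_pos_iff.2 hz)]

variable [IsGlobalField K]

theorem exists_mul_mem_of_mem_boundedMultipliers (hy : y ∈ unitSpace v)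
    (hy0 : ∀ w, w ≠ v → y w ≠ 0) (A : ValuationSubring K) (hA : A ≠ ⊤) :
    ∃ b : A, b ≠ 0 ∧ ∀ k ∈ boundedMultipliers v y, k * b ∈ A := by
  by_cases hv : Place.finite A hA = v
  · refine ⟨1, one_ne_zero, fun k hk => ?_⟩
    subst hv
    rw [OneMemClass.coe_one, mul_one]
    exact (Place.absValue_finite_le_one_iff hA).1 hk.1
  · let z : A.valuation.Completion := y (Place.finite A hA)
    obtain ⟨b, hb⟩ := Place.exists_valued_eq_valuation A z
    have hz : z ≠ 0 := hy0 _ hv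
    have hz1 : Valued.v z ≤ 1 :=
      show y (Place.finite A hA) ∈ (Place.finite A hA).closedUnitBall from interior_subset (hy.2 _)
    have hbA : b ∈ A := by rwa [← A.valuation_le_one_iff, ← hb]
    have hb0 : b ≠ 0 := by rwa [← A.valuation.ne_zero_iff, ← hb, Valuation.ne_zero_iff]
    refine ⟨⟨b, hbA⟩, fun h => hb0 (congrArg Subtype.val h), fun k hk => ?_⟩
    have hkz : Valued.v (Place.completionEmbedding A k * z) ≤ 1 := hk.2 _ hv
    rwa [map_mul, Place.valued_completionEmbedding, hb, ← map_mul, A.valuation_le_one_iff] at hkz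

theorem finite_boundedMultipliers (hy : y ∈ unitSpace v) (hy0 : ∀ w, w ≠ v → y w ≠ 0)
    (hyinv : ∀ᶠ w in cofinite, (y w)⁻¹ ∈ w.integers) : (boundedMultipliers v y).Finite := by
  let T : Set (Place K) := insert v {w | (y w)⁻¹ ∉ w.integers}
  have hT : T.Finite := Set.Finite.insert v hyinv
  let S : Set (ValuationSubring K) := {A | ∃ hA : A ≠ ⊤, Place.finite A hA ∈ T}
  let ring : Place K → ValuationSubring K
    | .infinite _ => ⊤
    | .finite A _ => A
  have hS : S.Finite := (hT.image ring).subset fun A ⟨hA, h⟩ => ⟨_, h, rfl⟩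
  refine finite_of_bounded_at_places hS (fun A hA => hA.1) (fun hempty => ?_)
    (fun A hA hAS k hk => ?_)
    (fun A hA => exists_mul_mem_of_mem_boundedMultipliers hy hy0 A hA.1)
    (exists_infinitePlace_le_of_mem_boundedMultipliers hy0)
  · rcases v with w | ⟨A, hA⟩
    · exact hempty.elim w
    · exact ⟨A, hA, Set.mem_insert _ _⟩
  · have hAT : Place.finite A hA ∉ T := fun h => hAS ⟨hA, h⟩
    have hAv : Place.finite A hA ≠ v := fun h => hAT (Set.mem_insert_iff.2 (Or.inl h))
    exact mem_of_mem_boundedMultipliers hAv (hy0 _ hAv)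
      (not_not.1 fun h => hAT (Set.mem_insert_of_mem _ h)) hk

theorem exists_le_energy_of_mem_classicalOrbit (y : unitSpace v)
    (hy : adeleClass (y : AdeleRing K) ∈ classicalOrbit v) : ∃ c : ℝ, ∀ γ, c ≤ energy y γ := by
  obtain ⟨hy0, hyinv⟩ := (adeleClass_mem_classicalOrbit_iff y.2.1).1 hy
  obtain ⟨c, hc⟩ := ((finite_boundedMultipliers y.2 hy0 hyinv).image
    fun k => Real.log (v.absValue k)).bddBelow
  refine ⟨min c 0, fun γ => ?_⟩
  have hx : γ.1.x = y.1 := congrArg Subtype.val γ.2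
  rcases le_total (v.absValue (γ.1.k : K)) 1 with h | h
  · refine (min_le_left _ _).trans (hc ⟨(γ.1.k : K), ⟨h, fun w _ => ?_⟩, rfl⟩)
    have := interior_subset (γ.1.range_mem.2 w)
    rwa [hx] at this
  · exact (min_le_right _ _).trans (Real.log_nonneg h)

end BoundedMultipliers

section IdealQuotients

open UniqueFactorizationMonoid

variable {S : Type*} [CommRing S] [IsDedekindDomain S] [Ring.HasFiniteQuotients S]

theorem two_mul_natCard_quotient_le {I P : Ideal S} (hI : I ≠ ⊥) (hP : P ≠ ⊥) (hP' : P ≠ ⊤) :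
    2 * Nat.card (S ⧸ I) ≤ Nat.card (S ⧸ (I * P)) := by
  have hindex := AddSubgroup.relIndex_mul_index (H := (I * P).toAddSubgroup)
    (K := I.toAddSubgroup) Ideal.mul_le_left
  change _ * Nat.card (S ⧸ I) = Nat.card (S ⧸ (I * P)) at hindex
  have := Ring.HasFiniteQuotients.finiteQuotient (mul_ne_zero hI hP)
  have hpos : 0 < Nat.card (S ⧸ (I * P)) := Nat.card_pos
  have h0 : (I * P).toAddSubgroup.relIndex I.toAddSubgroup ≠ 0 := by
    intro h0
    rw [h0, zero_mul] at hindex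
    exact hpos.ne hindex
  have h1 : (I * P).toAddSubgroup.relIndex I.toAddSubgroup ≠ 1 := by
    intro h1
    have hle : I ≤ I * P := AddSubgroup.relIndex_eq_one.1 h1
    have heq : I * P = I * 1 := by
      rw [mul_one]
      exact le_antisymm Ideal.mul_le_left hle
    exact hP' ((mul_left_cancel₀ hI heq).trans Ideal.one_eq_top)
  rw [← hindex]
  exact Nat.mul_le_mul_right _ (by lia)

theorem natCard_quotient_mul_two_pow_le {I J : Ideal S} (hI : I ≠ ⊥) (hJ : J ≠ ⊥) :
    Nat.card (S ⧸ I) * 2 ^ (normalizedFactors J).card ≤ Nat.card (S ⧸ (I * J)) := by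
  induction J using induction_on_prime generalizing I with
  | h₁ => exact absurd rfl hJ
  | h₂ J hunit => simp [Ideal.isUnit_iff.1 hunit, ← Ideal.one_eq_top]
  | h₃ J P hJ0 hP ih =>
    rw [normalizedFactors_mul hP.ne_zero hJ0, normalizedFactors_irreducible hP.irreducible,
      Multiset.card_add, Multiset.card_singleton, pow_add, pow_one, ← mul_assoc, ← mul_assoc,
      mul_comm _ 2]
    exact (Nat.mul_le_mul_right _ (two_mul_natCard_quotient_le hI hP.ne_zero
      (Ideal.isPrime_of_prime hP).ne_top)).trans (ih (mul_ne_zero hI hP.ne_zero) hJ0)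

end IdealQuotients

namespace Place

/-- The place `w` is nonarchimedean and its valuation ring contains `S`. -/
def IsOver (S : Type*) {K : Type*} [CommRing S] [Field K] [Algebra S K] : Place K → Prop
  | .infinite _ => False
  | .finite A _ => ∀ r : S, algebraMap S K r ∈ A

variable {S : Type*} (K : Type*) [CommRing S] [IsDedekindDomain S] [Field K] [Algebra S K]
  [IsFractionRing S K]

/-- The place of the fraction field `K` of `S` that is given by the `P`-adic valuation. -/
noncomputable def ofPrime (P : HeightOneSpectrum S) : Place K :=
  .finite (P.valuation K).valuationSubring <| by
    simp only [ne_eq, Valuation.valuationSubring_eq_top_iff, not_not]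
    infer_instance

variable {K}

theorem exists_eq_ofPrime {w : Place K} (hw : w.IsOver S) :
    ∃ P : HeightOneSpectrum S, w = ofPrime K P := by
  rcases w with w | ⟨A, hA⟩
  · exact hw.elim
  let f : S →+* A := (algebraMap S K).codRestrict A.toSubring hw
  let P : Ideal S := (IsLocalRing.maximalIdeal A).comap f
  have hinv (s : S) (hs : s ∉ P) : (algebraMap S K s)⁻¹ ∈ A := by
    by_contra h
    have hmem := A.mem_nonunits_iff_or.2 (Or.inr h)
    exact hs ((ValuationSubring.coe_mem_nonunits_iff (a := f s)).1 hmem)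
  have hP : P ≠ ⊥ := by
    intro h0
    refine hA (top_unique (SetLike.le_def.2 fun {z} _ => ?_))
    obtain ⟨a, b, hb, rfl⟩ := IsFractionRing.div_surjective (A := S) z
    rw [div_eq_mul_inv]
    refine A.mul_mem _ _ (hw a) (hinv b ?_)
    rw [h0, Ideal.mem_bot]
    exact nonZeroDivisors.ne_zero hb
  refine ⟨⟨P, inferInstance, hP⟩, ?_⟩
  simp only [ofPrime, Place.finite.injEq,
    ← HeightOneSpectrum.valuationSubringAtPrime_eq_valuationSubring]
  refine (ValuationSubring.eq_of_le_of_ne_top _ ?_ hA).symm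
  rintro _ ⟨a, s, hs, rfl⟩
  exact A.mul_mem _ _ (hw a) (hinv s hs)

variable [IsGlobalField K] {P : HeightOneSpectrum S}

theorem absValue_ofPrime_le_one_iff {x : K} :
    (ofPrime K P).absValue x ≤ 1 ↔ P.valuation K x ≤ 1 :=
  absValue_finite_le_one_iff _

theorem absValue_ofPrime_lt_one_iff {x : K} :
    (ofPrime K P).absValue x < 1 ↔ P.valuation K x < 1 := by
  by_cases hx : x = 0
  · simp [hx, absValue_zero]
  · rw [← not_iff_not, not_lt, not_lt, ← inv_le_one₀ (absValue_pos _ hx), ← absValue_inv,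
      absValue_ofPrime_le_one_iff, map_inv₀, inv_le_one₀ ((P.valuation K).pos_iff.2 hx)]

theorem absValue_ofPrime_le_one_of_not_le {k : K} {J : Ideal S} (hJ : ¬ J ≤ P.asIdeal)
    (hk : ∀ q ∈ J, ∃ z : S, k * algebraMap S K q = algebraMap S K z) :
    (ofPrime K P).absValue k ≤ 1 := by
  obtain ⟨q, hq, hqP⟩ := Set.not_subset.1 hJ
  obtain ⟨z, hz⟩ := hk q hq
  have hq1 : P.valuation K (algebraMap S K q) = 1 :=
    (P.valuation_le_one q).antisymm (not_lt.1 fun h => hqP ((P.valuation_lt_one_iff_mem q).1 h))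
  have hz1 : P.valuation K (k * algebraMap S K q) ≤ 1 := by
    rw [hz]
    exact P.valuation_le_one z
  rwa [map_mul, hq1, mul_one, ← absValue_ofPrime_le_one_iff] at hz1

/-- The conclusion says that `k` has at most a simple pole at `P`. -/
theorem absValue_ofPrime_mul_le_one_of_not_le {k π : K} {J : Ideal S} (hJ : ¬ J ≤ P.asIdeal)
    (hk : ∀ q ∈ P.asIdeal * J, ∃ z : S, k * algebraMap S K q = algebraMap S K z)
    (hπ : (ofPrime K P).absValue π < 1) : (ofPrime K P).absValue (k * π) ≤ 1 := by
  rw [absValue_ofPrime_lt_one_iff] at hπ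
  obtain ⟨a, s, hs⟩ := P.exists_primeCompl_mul_eq_of_integer π hπ.le
  have ha : a ∈ P.asIdeal := by
    have hlt : P.valuation K (π * algebraMap S K s) < 1 := by
      rw [map_mul]
      exact mul_lt_one_of_lt_of_le hπ (P.valuation_le_one _)
    rw [hs] at hlt
    exact (P.valuation_lt_one_iff_mem a).1 hlt
  have hsJ : ¬ Ideal.span {(s : S)} * J ≤ P.asIdeal := fun h =>
    (P.isPrime.mul_le.1 h).elim (fun hsP => s.2 ((Ideal.span_singleton_le_iff_mem _).1 hsP)) hJ
  refine absValue_ofPrime_le_one_of_not_le hsJ fun q hq => ?_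
  obtain ⟨q, hqJ, rfl⟩ := Ideal.mem_span_singleton_mul.1 hq
  obtain ⟨z, hz⟩ := hk (a * q) (Ideal.mul_mem_mul ha hqJ)
  refine ⟨z, ?_⟩
  rw [← hz, map_mul, map_mul, ← hs]
  ring

end Place

/-- A Minkowski-type property: an ideal `I` of `S` of sufficiently small index relative to
`[S : gS]` contains a nonzero element `x` such that `x / g` is small at all places that are
not over `S`. -/
def HasSmallElements (R S K : Type*) [CommRing R] [CommRing S] [Field K] [Algebra R S]
    [Algebra S K] : Prop :=
  ∀ ε : ℝ, 0 < ε → ∃ C : ℝ, ∀ I : Ideal S, I ≠ ⊥ → ∀ g : R, g ≠ 0 →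
    C * Nat.card (S ⧸ I) < Nat.card (S ⧸ Ideal.span {algebraMap R S g}) →
    ∃ x ∈ I, x ≠ 0 ∧ ∀ w : Place K, ¬ w.IsOver S →
      w.absValue (algebraMap S K x / algebraMap S K (algebraMap R S g)) < ε

theorem exists_ne_zero_algebraMap_mem (R : Type*) {S : Type*} [CommRing R] [CommRing S]
    [IsDomain S] [Algebra R S] [Algebra.IsAlgebraic R S] {I : Ideal S} (hI : I ≠ ⊥) :
    ∃ r : R, r ≠ 0 ∧ algebraMap R S r ∈ I := by
  obtain ⟨q, hq, hq0⟩ := Submodule.exists_mem_ne_zero_of_ne_bot hI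
  obtain ⟨r, hr, hqr⟩ := (Algebra.IsAlgebraic.isAlgebraic (R := R) q).exists_nonzero_dvd
    (mem_nonZeroDivisors_of_ne_zero hq0)
  exact ⟨r, hr, I.mem_of_dvd hqr hq⟩

theorem exists_div_mul_eq_of_mem_span_mul {S K : Type*} [CommRing S] [Field K] [Algebra S K]
    [FaithfulSMul S K] {I J : Ideal S} {g u x q : S} (hg : g ≠ 0) (hJI : J * I = Ideal.span {g})
    (hx : x ∈ Ideal.span {u} * I) (hq : q ∈ J) : ∃ z : S,
      algebraMap S K x / algebraMap S K g * algebraMap S K q =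
        algebraMap S K u * algebraMap S K z := by
  obtain ⟨y, hy, rfl⟩ := Ideal.mem_span_singleton_mul.1 hx
  have hqy := Ideal.mul_mem_mul hq hy
  rw [hJI] at hqy
  obtain ⟨z, hz⟩ := Ideal.mem_span_singleton'.1 hqy
  have hgK : algebraMap S K g ≠ 0 := by rwa [Ne, FaithfulSMul.algebraMap_eq_zero_iff]
  have hzK := congrArg (algebraMap S K) hz
  rw [map_mul, map_mul] at hzK
  refine ⟨z, ?_⟩
  rw [map_mul]
  field_simp
  linear_combination -(algebraMap S K u) * hzK

section SmallElements

open UniqueFactorizationMonoid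

variable {R S K : Type*} [CommRing R] [CommRing S] [IsDedekindDomain S] [Field K]
  [Algebra R S] [Algebra S K]

section

variable [Ring.HasFiniteQuotients S]

theorem mul_natCard_quotient_lt {I J : Ideal S} {u : S} {C : ℝ} {N : ℕ} (hu : u ≠ 0) (hI : I ≠ ⊥)
    (hJ : J ≠ ⊥) (hC : C * Nat.card (S ⧸ Ideal.span {u}) < 2 ^ N)
    (hN : N ≤ (normalizedFactors J).card) :
    C * Nat.card (S ⧸ (Ideal.span {u} * I)) < Nat.card (S ⧸ (J * I)) := by
  have := Ring.HasFiniteQuotients.finiteQuotient hI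
  have hpos : (0 : ℝ) < Nat.card (S ⧸ I) := by exact_mod_cast Nat.card_pos
  have hcard := natCard_quotient_mul_two_pow_le hI hJ
  calc C * (Nat.card (S ⧸ (Ideal.span {u} * I)) : ℝ)
      = C * Nat.card (S ⧸ Ideal.span {u}) * Nat.card (S ⧸ I) := by
        rw [natCard_quotient_span_mul hu, Nat.cast_mul, mul_assoc]
    _ < 2 ^ N * Nat.card (S ⧸ I) := by gcongr
    _ ≤ 2 ^ (normalizedFactors J).card * Nat.card (S ⧸ I) := by gcongr; exact one_le_two
    _ ≤ Nat.card (S ⧸ (J * I)) := by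
      rw [mul_comm, mul_comm J]
      exact_mod_cast hcard

theorem HasSmallElements.exists_mul_eq_mul [FaithfulSMul R S] [Algebra.IsAlgebraic R S]
    [FaithfulSMul S K] (h : HasSmallElements R S K) {ε : ℝ} (hε : 0 < ε) {u : S} (hu : u ≠ 0) :
    ∃ N : ℕ, ∀ J : Ideal S, J ≠ ⊥ → N ≤ (normalizedFactors J).card →
      ∃ k : K, k ≠ 0 ∧ (∀ w : Place K, ¬ w.IsOver S → w.absValue k < ε) ∧
        ∀ q ∈ J, ∃ z : S, k * algebraMap S K q = algebraMap S K u * algebraMap S K z := by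
  obtain ⟨C, hC⟩ := h ε hε
  obtain ⟨N, hN⟩ := pow_unbounded_of_one_lt (C * Nat.card (S ⧸ Ideal.span {u})) one_lt_two
  refine ⟨N, fun J hJ hJN => ?_⟩
  obtain ⟨g, hg0, hg⟩ := exists_ne_zero_algebraMap_mem R hJ
  have hgS : algebraMap R S g ≠ 0 := by rwa [Ne, FaithfulSMul.algebraMap_eq_zero_iff]
  obtain ⟨I, hI⟩ := Ideal.dvd_iff_le.2 ((Ideal.span_singleton_le_iff_mem _).2 hg)
  have hI0 : I ≠ ⊥ := by
    rintro rfl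
    rw [Ideal.mul_bot, Ideal.span_singleton_eq_bot] at hI
    exact hgS hI
  have hcard := mul_natCard_quotient_lt hu hI0 hJ hN hJN
  rw [← hI] at hcard
  obtain ⟨x, hx, hx0, hsmall⟩ := hC (Ideal.span {u} * I)
    (mul_ne_zero (mt Ideal.span_singleton_eq_bot.1 hu) hI0) g hg0 hcard
  refine ⟨_, div_ne_zero ?_ ?_, hsmall, fun q hq =>
    exists_div_mul_eq_of_mem_span_mul hgS hI.symm hx hq⟩
  all_goals rwa [Ne, FaithfulSMul.algebraMap_eq_zero_iff]

end

variable [IsFractionRing S K] [IsGlobalField K]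

theorem exists_ne_zero_absValue_lt (S : Type*) {K : Type*} [CommRing S] [IsDedekindDomain S]
    [Field K] [Algebra S K] [IsGlobalField K] [IsFractionRing S K] (v : Place K) {ε : ℝ}
    (hε : 0 < ε) : ∃ u : S, u ≠ 0 ∧ (v.IsOver S → v.absValue (algebraMap S K u) < ε) := by
  by_cases hv : v.IsOver S
  · obtain ⟨P, rfl⟩ := Place.exists_eq_ofPrime hv
    obtain ⟨r, hr, hr0⟩ := Submodule.exists_mem_ne_zero_of_ne_bot P.ne_bot
    have hr1 := Place.absValue_ofPrime_lt_one_iff.2 ((P.valuation_lt_one_iff_mem (K := K) r).2 hr)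
    obtain ⟨n, hn⟩ := exists_pow_lt_of_lt_one hε hr1
    refine ⟨r ^ n, pow_ne_zero _ hr0, fun _ => ?_⟩
    rwa [map_pow, Place.absValue_pow]
  · exact ⟨1, one_ne_zero, fun h => absurd h hv⟩

variable [Ring.HasFiniteQuotients S] [FaithfulSMul R S] [Algebra.IsAlgebraic R S]

theorem HasSmallElements.exists_absValue_lt_mul_mem (h : HasSmallElements R S K) {ε : ℝ}
    (hε : 0 < ε) (v : Place K) : ∃ N : ℕ, ∀ J : Ideal S, J ≠ ⊥ →
      N ≤ (normalizedFactors J).card →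
      (∀ P : HeightOneSpectrum S, v = Place.ofPrime K P → ¬ J ≤ P.asIdeal) →
      ∃ k : K, k ≠ 0 ∧ v.absValue k < ε ∧ (∀ w : Place K, ¬ w.IsOver S → w.absValue k ≤ 1) ∧
        ∀ q ∈ J, ∃ z : S, k * algebraMap S K q = algebraMap S K z := by
  have : FaithfulSMul S K :=
    (faithfulSMul_iff_algebraMap_injective S K).2 (IsFractionRing.injective S K)
  obtain ⟨u, hu, huv⟩ := exists_ne_zero_absValue_lt S v hε
  have huK : algebraMap S K u ≠ 0 := by rwa [Ne, FaithfulSMul.algebraMap_eq_zero_iff]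
  obtain ⟨N, hN⟩ := h.exists_mul_eq_mul (lt_min hε one_pos) hu
  refine ⟨N, fun J hJ hJN hJv => ?_⟩
  obtain ⟨k, hk0, hsmall, hk⟩ := hN J hJ hJN
  refine ⟨k, hk0, ?_, fun w hw => (hsmall w hw).le.trans (min_le_right _ _), fun q hq => ?_⟩
  · by_cases hv : v.IsOver S
    · obtain ⟨P, rfl⟩ := Place.exists_eq_ofPrime hv
      have hdiv : (Place.ofPrime K P).absValue (k / algebraMap S K u) ≤ 1 := by
        refine Place.absValue_ofPrime_le_one_of_not_le (hJv P rfl) fun q hq => ?_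
        obtain ⟨z, hz⟩ := hk q hq
        exact ⟨z, by rw [div_mul_eq_mul_div, hz, mul_div_cancel_left₀ _ huK]⟩
      rw [← div_mul_cancel₀ k huK, Place.absValue_mul]
      exact (mul_le_of_le_one_left (Place.absValue_pos _ huK).le hdiv).trans_lt (huv hv)
    · exact (hsmall v hv).trans_le (min_le_left _ _)
  · obtain ⟨z, hz⟩ := hk q hq
    exact ⟨u * z, by rw [hz, map_mul]⟩

theorem HasSmallElements.exists_absValue_lt_of_isOver (h : HasSmallElements R S K) {ε : ℝ}
    (hε : 0 < ε) {v w₀ : Place K} (hv : v ≠ w₀) (hw₀ : w₀.IsOver S) :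
    ∃ k : K, k ≠ 0 ∧ v.absValue k < ε ∧ ∀ w, w ≠ v → w ≠ w₀ → w.absValue k ≤ 1 := by
  obtain ⟨Q, rfl⟩ := Place.exists_eq_ofPrime hw₀
  obtain ⟨N, hN⟩ := h.exists_absValue_lt_mul_mem hε v
  have hcard : (normalizedFactors (Q.asIdeal ^ N)).card = N := by
    rw [normalizedFactors_pow, normalizedFactors_irreducible Q.irreducible, Multiset.card_nsmul,
      Multiset.card_singleton, mul_one]
  have hnot (P : HeightOneSpectrum S) (hP : Place.ofPrime K P ≠ Place.ofPrime K Q) :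
      ¬ Q.asIdeal ^ N ≤ P.asIdeal := fun hle =>
    hP (congrArg _ (HeightOneSpectrum.ext
      (Q.isMaximal.eq_of_le P.isPrime.ne_top (P.isPrime.le_of_pow_le hle)).symm))
  obtain ⟨k, hk0, hkv, hsmall, hk⟩ := hN _ (pow_ne_zero N Q.ne_bot) hcard.ge
    fun P hP => hnot P (hP ▸ hv)
  refine ⟨k, hk0, hkv, fun w _ hw => ?_⟩
  by_cases hwS : w.IsOver S
  · obtain ⟨P, rfl⟩ := Place.exists_eq_ofPrime hwS
    exact Place.absValue_ofPrime_le_one_of_not_le (hnot P hw) hk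
  · exact hsmall w hwS

theorem not_prod_asIdeal_le {S : Type*} [CommRing S] [IsDedekindDomain S]
    {F : Finset (HeightOneSpectrum S)} {P : HeightOneSpectrum S} (hP : P ∉ F) :
    ¬ ∏ Q ∈ F, Q.asIdeal ≤ P.asIdeal := by
  intro hle
  obtain ⟨Q, hQF, hQP⟩ := P.isPrime.prod_le.1 hle
  rw [HeightOneSpectrum.ext (Q.isMaximal.eq_of_le P.isPrime.ne_top hQP)] at hQF
  exact hP hQF

theorem card_normalizedFactors_prod_asIdeal {S : Type*} [CommRing S] [IsDedekindDomain S]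
    (F : Finset (HeightOneSpectrum S)) :
    (normalizedFactors (∏ P ∈ F, P.asIdeal)).card = F.card := by
  rw [Finset.prod_eq_multiset_prod, normalizedFactors_prod_eq _ fun I hI => ?_]
  · simp
  · obtain ⟨P, -, rfl⟩ := Multiset.mem_map.1 hI
    exact P.irreducible

/-- At the places of the infinite set `T` the element may have simple poles. -/
theorem HasSmallElements.exists_absValue_lt_of_infinite (h : HasSmallElements R S K) {ε : ℝ}
    (hε : 0 < ε) {v : Place K} {T : Set (Place K)} (hT : T.Infinite) (hv : v ∉ T)
    (hTS : {w ∈ T | ¬ w.IsOver S}.Finite) :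
    ∃ k : K, k ≠ 0 ∧ v.absValue k < ε ∧ ∀ w, w ≠ v → w.absValue k ≤ 1 ∨
      w ∈ T ∧ ∀ π, w.absValue π < 1 → w.absValue (k * π) ≤ 1 := by
  classical
  have hT' : {P : HeightOneSpectrum S | Place.ofPrime K P ∈ T}.Infinite := by
    refine fun hfin => hT ((hTS.union (hfin.image (Place.ofPrime K))).subset fun w hw => ?_)
    refine or_iff_not_imp_left.2 fun hwS => ?_
    obtain ⟨P, rfl⟩ := Place.exists_eq_ofPrime (not_not.1 fun hw' => hwS ⟨hw, hw'⟩)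
    exact ⟨P, hw, rfl⟩
  obtain ⟨N, hN⟩ := h.exists_absValue_lt_mul_mem hε v
  obtain ⟨F, hFT, hFN⟩ := hT'.exists_subset_card_eq N
  obtain ⟨k, hk0, hkv, hsmall, hk⟩ := hN (∏ P ∈ F, P.asIdeal)
    (Finset.prod_ne_zero_iff.2 fun P _ => P.ne_bot)
    (card_normalizedFactors_prod_asIdeal F ▸ hFN.ge)
    fun P hP => not_prod_asIdeal_le fun hPF => hv (hP ▸ hFT hPF)
  refine ⟨k, hk0, hkv, fun w _ => ?_⟩
  by_cases hwS : w.IsOver S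
  · obtain ⟨P, rfl⟩ := Place.exists_eq_ofPrime hwS
    by_cases hPF : P ∈ F
    · rw [← Finset.mul_prod_erase F _ hPF] at hk
      exact Or.inr ⟨hFT hPF, fun π hπ => Place.absValue_ofPrime_mul_le_one_of_not_le
        (not_prod_asIdeal_le (Finset.notMem_erase P F)) hk hπ⟩
    · exact Or.inl (Place.absValue_ofPrime_le_one_of_not_le (not_prod_asIdeal_le hPF) hk)
  · exact Or.inl (hsmall w hwS)

end SmallElements

theorem mem_of_isIntegral {R K : Type*} [CommRing R] [Field K] [Algebra R K]
    {A : ValuationSubring K} (hA : ∀ r : R, algebraMap R K r ∈ A) {x : K} (hx : IsIntegral R x) :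
    x ∈ A := by
  let : Algebra R A := ((algebraMap R K).codRestrict A.toSubring hA).toAlgebra
  have : IsScalarTower R A K := IsScalarTower.of_algebraMap_eq fun _ => rfl
  obtain ⟨a, ha⟩ := (IsIntegrallyClosed.isIntegral_iff (R := A) (K := K)).1 hx.tower_top
  rw [← ha]
  exact a.2

section NumberField

open NumberField
open scoped NNReal

theorem isOver_ringOfIntegers {K : Type*} [Field K] (A : ValuationSubring K) (hA : A ≠ ⊤) :
    (Place.finite A hA).IsOver (𝓞 K) :=
  fun r => mem_of_isIntegral (R := ℤ) (fun n => by simp) r.2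

theorem absValue_infinite_lt {K : Type*} [Field K] {w : InfinitePlace K} {x : K} {ε : ℝ}
    (hx : w x < min ε 1) : (Place.infinite w).absValue x < ε :=
  (pow_le_of_le_one (apply_nonneg w x) (hx.le.trans (min_le_right _ _))
    w.mult_ne_zero).trans_lt (hx.trans_le (min_le_left _ _))

variable (K : Type*) [Field K] [NumberField K]

theorem exists_minkowskiBound_eq : ∃ C : ℝ, 0 ≤ C ∧ ∀ (I : Ideal (𝓞 K))
    (hI : (I : FractionalIdeal (nonZeroDivisors (𝓞 K)) K) ≠ 0),
    mixedEmbedding.minkowskiBound K (Units.mk0 _ hI) =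
      ENNReal.ofReal (C * Nat.card (𝓞 K ⧸ I)) := by
  classical
  let V := MeasureTheory.volume (ZSpan.fundamentalDomain (mixedEmbedding.latticeBasis K))
  have hV : V ≠ ⊤ := (ZSpan.fundamentalDomain_isBounded _).measure_lt_top.ne
  let n := Module.finrank ℝ (mixedEmbedding.mixedSpace K)
  refine ⟨V.toReal * 2 ^ n, by positivity, fun I hI => ?_⟩
  rw [mixedEmbedding.minkowskiBound,
    mixedEmbedding.volume_fundamentalDomain_fractionalIdealLatticeBasis, Units.val_mk0,
    FractionalIdeal.coeIdeal_absNorm]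
  change ENNReal.ofReal (((Nat.card (𝓞 K ⧸ I) : ℚ) : ℝ)) * V * 2 ^ n = _
  rw [Rat.cast_natCast, mul_comm _ (Nat.card (𝓞 K ⧸ I) : ℝ), ENNReal.ofReal_mul (by positivity),
    ENNReal.ofReal_mul (by positivity), ENNReal.ofReal_toReal hV, mul_assoc,
    ENNReal.ofReal_pow zero_le_two, ENNReal.ofReal_ofNat]

open scoped Classical in
theorem ofReal_prod_pow_mult_le_volume_convexBodyLT (f : InfinitePlace K → ℝ≥0) :
    ENNReal.ofReal (∏ w, (f w : ℝ) ^ w.mult) ≤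
      MeasureTheory.volume (mixedEmbedding.convexBodyLT K f) := by
  have hcoe : (∏ w, (f w : ℝ) ^ w.mult) = (∏ w, f w ^ w.mult : ℝ≥0) := by push_cast; rfl
  rw [mixedEmbedding.convexBodyLT_volume, hcoe, ENNReal.ofReal_coe_nnreal]
  exact le_mul_of_one_le_left' (ENNReal.one_le_coe_iff.2
    (mixedEmbedding.one_le_convexBodyLTFactor K))

theorem exists_ne_zero_mem_ideal_infinitePlace_lt : ∃ C : ℝ, ∀ I : Ideal (𝓞 K), I ≠ ⊥ →
    ∀ f : InfinitePlace K → ℝ≥0, C * Nat.card (𝓞 K ⧸ I) < ∏ w, (f w : ℝ) ^ w.mult →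
      ∃ x ∈ I, x ≠ 0 ∧ ∀ w : InfinitePlace K, w (x : K) < f w := by
  obtain ⟨C, hC0, hC⟩ := exists_minkowskiBound_eq K
  refine ⟨C, fun I hI f hf => ?_⟩
  have hI' : (I : FractionalIdeal (nonZeroDivisors (𝓞 K)) K) ≠ 0 := by
    rwa [Ne, FractionalIdeal.coeIdeal_eq_zero]
  classical
  have hpos : 0 < ∏ w, (f w : ℝ) ^ w.mult := lt_of_le_of_lt (by positivity) hf
  have hlt : mixedEmbedding.minkowskiBound K (Units.mk0 _ hI') <
      MeasureTheory.volume (mixedEmbedding.convexBodyLT K f) := by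
    rw [hC]
    exact ((ENNReal.ofReal_lt_ofReal_iff hpos).2 hf).trans_le
      (ofReal_prod_pow_mult_le_volume_convexBodyLT K f)
  obtain ⟨a, ha, ha0, hw⟩ := mixedEmbedding.exists_ne_zero_mem_ideal_lt K (Units.mk0 _ hI') hlt
  obtain ⟨x, hx, rfl⟩ := (FractionalIdeal.mem_coeIdeal _).1 ha
  exact ⟨x, hx, fun h0 => ha0 (by rw [h0, map_zero]), hw⟩

theorem natCard_quotient_span_intCast (g : ℤ) :
    Nat.card (𝓞 K ⧸ Ideal.span {algebraMap ℤ (𝓞 K) g}) = g.natAbs ^ Module.finrank ℚ K := by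
  change Ideal.absNorm (Ideal.span {algebraMap ℤ (𝓞 K) g}) = _
  rw [Ideal.absNorm_span_singleton, Algebra.norm_algebraMap_of_basis
    (Module.Free.chooseBasis ℤ (𝓞 K)), Int.natAbs_pow,
    ← Module.finrank_eq_card_chooseBasisIndex, RingOfIntegers.rank]

theorem hasSmallElements_ringOfIntegers : HasSmallElements ℤ (𝓞 K) K := by
  intro ε hε
  obtain ⟨C, hC⟩ := exists_ne_zero_mem_ideal_infinitePlace_lt K
  let δ : ℝ≥0 := ⟨min ε 1, (lt_min hε one_pos).le⟩
  have hδ : (0 : ℝ) < δ := lt_min hε one_pos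
  refine ⟨C / (δ : ℝ) ^ Module.finrank ℚ K, fun I hI g hg hIg => ?_⟩
  obtain ⟨x, hx, hx0, hw⟩ := hC I hI (fun _ => δ * Real.nnabs g) (by
    rw [natCard_quotient_span_intCast, div_mul_eq_mul_div, div_lt_iff₀ (by positivity)] at hIg
    rw [Finset.prod_pow_eq_pow_sum, InfinitePlace.sum_mult_eq]
    simpa [mul_pow, mul_comm] using hIg)
  refine ⟨x, hx, hx0, fun w hwS => ?_⟩
  rcases w with w | ⟨A, hA⟩
  · have hwg : w (algebraMap (𝓞 K) K (algebraMap ℤ (𝓞 K) g)) = |(g : ℝ)| := by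
      simp [← InfinitePlace.norm_embedding_eq]
    refine absValue_infinite_lt ?_
    rw [map_div₀, hwg, div_lt_iff₀ (by positivity)]
    exact hw w
  · exact absurd (isOver_ringOfIntegers A hA) hwS

variable {K}

theorem exists_absValue_lt_of_ne_infinitePlace [IsGlobalField K] {ε : ℝ} (hε : 0 < ε)
    {v : Place K} {w₀ : InfinitePlace K} (hv : v ≠ Place.infinite w₀) :
    ∃ k : K, k ≠ 0 ∧ v.absValue k < ε ∧
      ∀ w, w ≠ v → w ≠ Place.infinite w₀ → w.absValue k ≤ 1 := by
  obtain ⟨u, hu, huv⟩ := exists_ne_zero_absValue_lt (𝓞 K) v hε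
  obtain ⟨C, hC⟩ := exists_ne_zero_mem_ideal_infinitePlace_lt K
  have hε' : 0 < min ε 1 := lt_min hε one_pos
  let δ : ℝ≥0 := ⟨min ε 1, hε'.le⟩
  have hδ : δ ≠ 0 := NNReal.coe_ne_zero.1 hε'.ne'
  obtain ⟨f, hf, hprod⟩ := mixedEmbedding.adjust_f K (w₁ := w₀) (f := fun _ => δ)
    (Real.toNNReal (C * Nat.card (𝓞 K ⧸ Ideal.span {u}) + 1)) fun _ _ => hδ
  obtain ⟨x, hx, hx0, hw⟩ := hC (Ideal.span {u}) (by rwa [Ne, Ideal.span_singleton_eq_bot]) f (by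
    have hprod' := congrArg NNReal.toReal hprod
    push_cast at hprod'
    rw [hprod']
    exact (lt_add_one _).trans_le (Real.le_coe_toNNReal _))
  obtain ⟨r, rfl⟩ := Ideal.mem_span_singleton'.1 hx
  have hsmall (w : InfinitePlace K) (hne : w ≠ w₀) :
      (Place.infinite w).absValue (r * u : 𝓞 K) < min ε 1 :=
    absValue_infinite_lt (((hw w).trans_eq (congrArg NNReal.toReal (hf w hne))).trans_eq
      (min_eq_left (min_le_right _ _)).symm)
  refine ⟨(r * u : 𝓞 K), by simpa using hx0, ?_, fun w hwv hw₀ => ?_⟩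
  · rcases v with v | ⟨A, hA⟩
    · exact (hsmall v fun h => hv (congrArg _ h)).trans_le (min_le_left _ _)
    · have hr := Place.absValue_finite_le_one hA (isOver_ringOfIntegers A hA r)
      have hu0 : (u : K) ≠ 0 := by simpa using hu
      have hru : ((r * u : 𝓞 K) : K) = (r : K) * u := map_mul _ _ _
      rw [hru, Place.absValue_mul]
      exact (mul_le_of_le_one_left (Place.absValue_pos _ hu0).le hr).trans_lt
        (huv (isOver_ringOfIntegers A hA))
  · rcases w with w | ⟨A, hA⟩
    · exact ((hsmall w fun h => hw₀ (congrArg _ h)).trans_le (min_le_right _ _)).le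
    · exact Place.absValue_finite_le_one hA (isOver_ringOfIntegers A hA _)

end NumberField

section FunctionField

open scoped Polynomial

theorem natCard_degreeLT (F : Type*) [Field F] (d : ℕ) :
    Nat.card (Polynomial.degreeLT F d) = Nat.card F ^ d := by
  rw [Nat.card_congr (Polynomial.degreeLTEquiv F d).toEquiv, Nat.card_fun, Nat.card_fin]

theorem degree_X_pow_mul_lt {R : Type*} [Semiring R] {q : R[X]} {d B : ℕ}
    (hq : q.degree < (d : WithBot ℕ))
    (hcoeff : ∀ j < B, (Polynomial.X ^ B * q).coeff (d + j) = 0) :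
    (Polynomial.X ^ B * q).degree < (d : WithBot ℕ) := by
  rw [Polynomial.degree_lt_iff_coeff_zero]
  intro m hm
  obtain ⟨j, rfl⟩ := Nat.exists_eq_add_of_le hm
  rcases lt_or_ge j B with hj | hj
  · exact hcoeff j hj
  · rw [Polynomial.coeff_X_pow_mul', if_pos (by lia)]
    exact (Polynomial.degree_lt_iff_coeff_zero _ _).1 hq _ (by lia)

theorem exists_ne_zero_forall_degree_X_pow_mul_lt {F S ι : Type*} [Field F] [Finite F]
    [CommRing S] [Finite ι] (f : (ι → F[X]) →+ S) (d B : ℕ) {I : Ideal S} [Finite (S ⧸ I)]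
    (h : Nat.card F ^ (Nat.card ι * B) * Nat.card (S ⧸ I) < Nat.card F ^ (Nat.card ι * d)) :
    ∃ a : ι → F[X], a ≠ 0 ∧ f a ∈ I ∧ ∀ i, (Polynomial.X ^ B * a i).degree < (d : WithBot ℕ) := by
  classical
  let V := Polynomial.degreeLT F d
  have : Finite V := Finite.of_equiv _ (Polynomial.degreeLTEquiv F d).symm.toEquiv
  -- pigeonhole on the class of `f a` modulo `I` and the coefficients of degree at least `d`
  let φ : (ι → V) → (S ⧸ I) × (ι → Fin B → F) := fun a =>
    (Ideal.Quotient.mk I (f fun i => (a i : F[X])),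
      fun i j => (Polynomial.X ^ B * (a i : F[X])).coeff (d + j))
  have hφ : ¬ Function.Injective φ := fun hinj => by
    have hle := Nat.card_le_card_of_injective φ hinj
    rw [Nat.card_prod, Nat.card_fun, Nat.card_fun, Nat.card_fun, natCard_degreeLT, Nat.card_fin,
      ← pow_mul, ← pow_mul, mul_comm d, mul_comm B, mul_comm (Nat.card (S ⧸ I))] at hle
    exact hle.not_gt h
  obtain ⟨a, b, hab, hne⟩ := Function.not_injective_iff.1 hφ
  obtain ⟨hI, hcoeff⟩ := Prod.ext_iff.1 hab
  refine ⟨fun i => (a i : F[X]) - b i, fun h0 => hne ?_, ?_, fun i => ?_⟩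
  · exact funext fun i => Subtype.ext (sub_eq_zero.1 (congrFun h0 i))
  · have hsub := (Ideal.Quotient.mk_eq_mk_iff_sub_mem _ _).1 hI
    rwa [← map_sub] at hsub
  · refine degree_X_pow_mul_lt (Polynomial.mem_degreeLT.1 (V.sub_mem (a i).2 (b i).2))
      fun j hj => ?_
    rw [mul_sub, Polynomial.coeff_sub, sub_eq_zero]
    exact congrFun (congrFun hcoeff i) ⟨j, hj⟩

theorem exists_linearIndependent_integralClosure (R F K : Type*) [CommRing R] [IsDomain R]
    [Field F] [Field K] [Algebra R F] [IsFractionRing R F] [Algebra F K] [FiniteDimensional F K]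
    [Algebra R K] [IsScalarTower R F K] :
    ∃ (s : Finset K) (e : s → integralClosure R K),
      LinearIndependent R e ∧ Nat.card s = Module.finrank F K := by
  obtain ⟨s, b, hb⟩ := FiniteDimensional.exists_is_basis_integral R F K
  refine ⟨s, fun i => ⟨b i, hb i⟩, ?_, (Module.finrank_eq_nat_card_basis b).symm⟩
  have hli : LinearIndependent R b := (LinearIndependent.iff_fractionRing R F).2 b.linearIndependent
  exact hli.of_comp (integralClosure R K).val.toLinearMap

theorem isDedekindDomain_integralClosure (R F K : Type*) [CommRing R] [IsDomain R]
    [IsPrincipalIdealRing R] [Ring.HasFiniteQuotients R] [Field F] [Field K] [Algebra R F]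
    [IsFractionRing R F] [Algebra F K] [FiniteDimensional F K] [Algebra R K]
    [IsScalarTower R F K] : IsDedekindDomain (integralClosure R K) := by
  have := hasFiniteQuotients_of_isFractionRing R F K (B := integralClosure R K)
  have := integralClosure.isIntegrallyClosedOfFiniteExtension (R := R) F (L := K)
  exact {}

theorem eventually_absValue_pow_mul_sum_lt {K : Type*} [Field K] [IsGlobalField K]
    {A : ValuationSubring K} (hA : A ≠ ⊤) {x : K} (hx : x ∈ A.nonunits) {ι : Type*} [Fintype ι]
    (e : ι → K) {ε : ℝ} (hε : 0 < ε) : ∀ᶠ B : ℕ in atTop, ∀ z : ι → K, (∀ i, z i ∈ A) →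
      (Place.finite A hA).absValue (x ^ B * ∑ i, z i * e i) < ε := by
  have habs0 : 0 ≤ (Place.finite A hA).absValue x := by
    rcases eq_or_ne x 0 with rfl | hx0
    · exact (Place.absValue_zero _).ge
    · exact (Place.absValue_pos _ hx0).le
  have hpow := tendsto_pow_atTop_nhds_zero_of_lt_one habs0 (Place.absValue_finite_lt_one hA hx)
  have hmem : ∀ᶠ B in atTop, ∀ i, x ^ B * e i ∈ A := by
    refine eventually_all.2 fun i => ?_
    have hi := hpow.mul_const ((Place.finite A hA).absValue (e i))
    rw [zero_mul] at hi
    filter_upwards [hi.eventually_le_const one_pos] with B hB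
    rwa [← Place.absValue_finite_le_one_iff hA, Place.absValue_mul, Place.absValue_pow]
  obtain ⟨M, hM⟩ := exists_pow_lt_of_lt_one hε (Place.absValue_finite_lt_one hA hx)
  filter_upwards [(tendsto_sub_atTop_nat M).eventually hmem, eventually_ge_atTop M]
    with B hB hMB z hz
  have hsplit : x ^ B * ∑ i, z i * e i = x ^ M * ∑ i, z i * (x ^ (B - M) * e i) := by
    rw [← Nat.add_sub_of_le hMB, Nat.add_sub_cancel_left, pow_add, mul_assoc, Finset.mul_sum]
    exact congrArg _ (Finset.sum_congr rfl fun i _ => by ring)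
  have hsum : ∑ i, z i * (x ^ (B - M) * e i) ∈ A :=
    sum_mem fun i _ => A.mul_mem _ _ (hz i) (hB i)
  rw [hsplit, Place.absValue_mul, Place.absValue_pow]
  exact (mul_le_of_le_one_right (pow_nonneg habs0 M)
    (Place.absValue_finite_le_one hA hsum)).trans_lt hM

theorem exists_forall_absValue_inv_pow_mul_sum_lt {K : Type*} [Field K] [IsGlobalField K] (t : K)
    {ι : Type*} [Fintype ι] (e : ι → K) {ε : ℝ} (hε : 0 < ε) :
    ∃ B : ℕ, ∀ (A : ValuationSubring K) (hA : A ≠ ⊤), t ∉ A → ∀ z : ι → K, (∀ i, z i ∈ A) →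
      (Place.finite A hA).absValue (t⁻¹ ^ B * ∑ i, z i * e i) < ε := by
  have : Finite {A : ValuationSubring K | A ≠ ⊤ ∧ t ∉ A} := finite_valuationSubring_notMem t
  obtain ⟨B, hB⟩ := (eventually_all.2 fun A : {A : ValuationSubring K | A ≠ ⊤ ∧ t ∉ A} =>
    eventually_absValue_pow_mul_sum_lt A.2.1 (A.1.inv_mem_nonunits_iff.2 (Or.inr A.2.2)) e
      hε).exists
  exact ⟨B, fun A hA htA => hB ⟨A, hA, htA⟩⟩

variable {K : Type*} [Field K] {p : ℕ} [Fact p.Prime] [Algebra (RatFunc (ZMod p)) K]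

theorem algebraMap_div_mem {A : ValuationSubring K}
    (hA : algebraMap (RatFunc (ZMod p)) K RatFunc.X ∉ A) {h g : (ZMod p)[X]}
    (hg : g ≠ 0) (hhg : h.degree ≤ g.degree) :
    algebraMap (RatFunc (ZMod p)) K (algebraMap _ _ h / algebraMap _ _ g) ∈ A := by
  classical
  let B := A.comap (algebraMap (RatFunc (ZMod p)) K)
  have hmem (c : ZMod p) : B.valuation (algebraMap _ _ c) ≤ 1 :=
    (B.valuation_le_one_iff _).2 (B.map_zmod_mem (algebraMap _ _) c)
  have : B.valuation.IsTrivialOn (ZMod p) := by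
    refine ⟨fun c hc => (hmem c).antisymm ?_⟩
    have hinv := hmem c⁻¹
    rwa [map_inv₀, map_inv₀, inv_le_one₀ (by simpa [zero_lt_iff] using hc)] at hinv
  have hX : 1 < B.valuation RatFunc.X := by
    rw [← not_le, B.valuation_le_one_iff]
    exact hA
  have hB : B = (RatFunc.inftyValuation (ZMod p)).valuationSubring := by
    rw [← (Valuation.isEquiv_iff_valuationSubring _ _).1
      (RatFunc.valuation_isEquiv_inftyValuation_of_one_lt_valuation_X hX),
      ValuationSubring.valuationSubring_valuation]
  change algebraMap _ (RatFunc (ZMod p)) h / algebraMap _ _ g ∈ B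
  rw [hB, Valuation.mem_valuationSubring_iff, map_div₀]
  rcases eq_or_ne h 0 with rfl | hh
  · simp
  have hval (q : (ZMod p)[X]) (hq : q ≠ 0) : RatFunc.inftyValuation (ZMod p)
      (algebraMap _ (RatFunc (ZMod p)) q) = WithZero.exp (q.natDegree : ℤ) :=
    RatFunc.inftyValuation.polynomial _ hq
  rw [hval h hh, hval g hg, div_le_one₀ (by simp), WithZero.exp_le_exp]
  exact_mod_cast Polynomial.natDegree_le_natDegree hhg

variable [Algebra (ZMod p)[X] K] [IsScalarTower (ZMod p)[X] (RatFunc (ZMod p)) K]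

theorem isOver_integralClosure {A : ValuationSubring K} (hA : A ≠ ⊤)
    (hX : algebraMap (RatFunc (ZMod p)) K RatFunc.X ∈ A) :
    (Place.finite A hA).IsOver (integralClosure (ZMod p)[X] K) := by
  refine fun r => mem_of_isIntegral (R := (ZMod p)[X]) (fun q => ?_) r.2
  rw [IsScalarTower.algebraMap_apply (ZMod p)[X] (RatFunc (ZMod p)) K]
  exact algebraMap_polynomial_mem hX q

theorem sum_smul_div_algebraMap_eq {ι : Type*} [Fintype ι] (e : ι → K) (a : ι → (ZMod p)[X])
    (g : (ZMod p)[X]) (B : ℕ) :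
    (∑ i, a i • e i) / algebraMap (ZMod p)[X] K g =
      (algebraMap (RatFunc (ZMod p)) K RatFunc.X)⁻¹ ^ B *
        ∑ i, algebraMap (RatFunc (ZMod p)) K
          (algebraMap _ _ (Polynomial.X ^ B * a i) / algebraMap _ _ g) * e i := by
  have hX : algebraMap (RatFunc (ZMod p)) K RatFunc.X ≠ 0 := (map_ne_zero _).2 RatFunc.X_ne_zero
  rw [Finset.sum_div, Finset.mul_sum]
  refine Finset.sum_congr rfl fun i _ => ?_
  rw [Algebra.smul_def, IsScalarTower.algebraMap_apply (ZMod p)[X] (RatFunc (ZMod p)) K (a i),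
    IsScalarTower.algebraMap_apply (ZMod p)[X] (RatFunc (ZMod p)) K g, map_div₀, map_mul, map_mul,
    map_pow, map_pow, RatFunc.algebraMap_X, inv_pow]
  field_simp

instance faithfulSMul_integralClosure_polynomial :
    FaithfulSMul (ZMod p)[X] (integralClosure (ZMod p)[X] K) := by
  refine (faithfulSMul_iff_algebraMap_injective _ _).2 (Function.Injective.of_comp
    (f := algebraMap (integralClosure (ZMod p)[X] K) K) ?_)
  rw [← RingHom.coe_comp, ← IsScalarTower.algebraMap_eq,
    IsScalarTower.algebraMap_eq _ (RatFunc (ZMod p)) K]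
  exact (algebraMap _ K).injective.comp (IsFractionRing.injective (ZMod p)[X] (RatFunc (ZMod p)))

variable [FiniteDimensional (RatFunc (ZMod p)) K]

instance isDedekindDomain_integralClosure_polynomial :
    IsDedekindDomain (integralClosure (ZMod p)[X] K) :=
  isDedekindDomain_integralClosure _ (RatFunc (ZMod p)) _

instance hasFiniteQuotients_integralClosure_polynomial :
    Ring.HasFiniteQuotients (integralClosure (ZMod p)[X] K) :=
  hasFiniteQuotients_of_isFractionRing (ZMod p)[X] (RatFunc (ZMod p)) K

instance isFractionRing_integralClosure_polynomial :
    IsFractionRing (integralClosure (ZMod p)[X] K) K :=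
  integralClosure.isFractionRing_of_finite_extension (RatFunc (ZMod p)) K

variable (K p) in
theorem hasSmallElements_integralClosure [IsGlobalField K] :
    HasSmallElements (ZMod p)[X] (integralClosure (ZMod p)[X] K) K := by
  intro ε hε
  let R := (ZMod p)[X]
  let F := RatFunc (ZMod p)
  let S := integralClosure R K
  let t : K := algebraMap F K RatFunc.X
  obtain ⟨s, e, he, hs⟩ := exists_linearIndependent_integralClosure R F K
  obtain ⟨B, hB⟩ := exists_forall_absValue_inv_pow_mul_sum_lt t (fun i => (e i : K)) hε
  refine ⟨(p : ℝ) ^ (Nat.card s * B), fun I hI g hg hIg => ?_⟩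
  have : Finite (S ⧸ I) := Ring.HasFiniteQuotients.finiteQuotient hI
  have : Finite (R ⧸ Ideal.span {g}) :=
    Ring.HasFiniteQuotients.finiteQuotient (mt Ideal.span_singleton_eq_bot.1 hg)
  have hcard : Nat.card (S ⧸ Ideal.span {algebraMap R S g}) ≤ p ^ (Nat.card s * g.natDegree) := by
    have hle := natCard_quotient_le_pow_finrank R F K
      (Ideal.mem_span_singleton_self (algebraMap R S g))
    rwa [natCard_polynomial_quotient hg, Nat.card_zmod, ← pow_mul, ← hs, mul_comm] at hle
  obtain ⟨a, ha0, haI, hdeg⟩ := exists_ne_zero_forall_degree_X_pow_mul_lt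
    (Fintype.linearCombination R e).toAddMonoidHom g.natDegree B (I := I) (by
      rw [Nat.card_zmod]
      exact lt_of_lt_of_le (by exact_mod_cast hIg) hcard)
  refine ⟨_, haI, fun h0 => ha0 ?_, fun w hw => ?_⟩
  · exact funext (Fintype.linearIndependent_iff.1 he a h0)
  · rcases w with w | ⟨A, hA⟩
    · exact ((isEmpty_infinitePlace_of_algebra_ratFunc K p).false w).elim
    have hsum : algebraMap S K (Fintype.linearCombination R e a) = ∑ i, a i • (e i : K) := by
      simp [Fintype.linearCombination_apply, S, R, Algebra.smul_def]
    change (Place.finite A hA).absValue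
      (algebraMap S K (Fintype.linearCombination R e a) / algebraMap R K g) < ε
    rw [hsum, sum_smul_div_algebraMap_eq _ _ _ B]
    have htA : t ∉ A := fun htA => hw (isOver_integralClosure hA htA)
    exact hB A hA htA _ fun i => algebraMap_div_mem htA hg
      ((hdeg i).le.trans (Polynomial.degree_eq_natDegree hg).ge)

end FunctionField

theorem finite_setOf_not_isOver_ringOfIntegers (K : Type*) [Field K] [NumberField K]
    [IsGlobalField K] :
    {w : Place K | ¬ w.IsOver (NumberField.RingOfIntegers K)}.Finite := by
  refine (mem_cofinite.1 (Place.eventually_exists_finite K)).subset ?_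
  rintro w hw ⟨A, hA, rfl⟩
  exact hw (isOver_ringOfIntegers A hA)

section FunctionField

open scoped Polynomial

variable (K : Type*) [Field K] [IsGlobalField K] (p : ℕ) [Fact p.Prime]
  [Algebra (RatFunc (ZMod p)) K] [Algebra (ZMod p)[X] K]
  [IsScalarTower (ZMod p)[X] (RatFunc (ZMod p)) K]

theorem finite_setOf_not_isOver_integralClosure :
    {w : Place K | ¬ w.IsOver (integralClosure (ZMod p)[X] K)}.Finite := by
  let t : K := algebraMap (RatFunc (ZMod p)) K RatFunc.X
  have : Finite {A : ValuationSubring K | A ≠ ⊤ ∧ t ∉ A} := finite_valuationSubring_notMem t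
  refine (Set.finite_range fun A : {A : ValuationSubring K | A ≠ ⊤ ∧ t ∉ A} =>
    Place.finite A.1 A.2.1).subset ?_
  rintro (w | ⟨A, hA⟩) hw
  · exact ((isEmpty_infinitePlace_of_algebra_ratFunc K p).false w).elim
  · exact ⟨⟨A, hA, fun htA => hw (isOver_integralClosure hA htA)⟩, rfl⟩

end FunctionField

section GlobalField

variable {K : Type*} [Field K] [IsGlobalField K] {v : Place K} {ε : ℝ}

open scoped Polynomial in
theorem exists_absValue_lt_of_ne {w₀ : Place K} (hv : v ≠ w₀) (hε : 0 < ε) :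
    ∃ k : K, k ≠ 0 ∧ v.absValue k < ε ∧ ∀ w, w ≠ v → w ≠ w₀ → w.absValue k ≤ 1 := by
  rcases IsGlobalField.numberField_or_functionField (K := K) with _ | ⟨p, _, _, _⟩
  · rcases w₀ with w₀ | ⟨A, hA⟩
    · exact exists_absValue_lt_of_ne_infinitePlace hε hv
    · exact (hasSmallElements_ringOfIntegers K).exists_absValue_lt_of_isOver hε hv
        (isOver_ringOfIntegers A hA)
  · rcases w₀ with w₀ | ⟨A, hA⟩
    · exact ((isEmpty_infinitePlace_of_algebra_ratFunc K p).false w₀).elim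
    · obtain ⟨_, _, hX⟩ := exists_algebra_ratFunc_mem (p := p) A
      let : Algebra (ZMod p)[X] K := Algebra.compHom K (algebraMap _ (RatFunc (ZMod p)))
      have : IsScalarTower (ZMod p)[X] (RatFunc (ZMod p)) K := .of_algebraMap_eq fun _ => rfl
      exact (hasSmallElements_integralClosure K p).exists_absValue_lt_of_isOver hε hv
        (isOver_integralClosure hA hX)

open scoped Polynomial in
theorem exists_absValue_lt_of_infinite {T : Set (Place K)} (hT : T.Infinite) (hv : v ∉ T)
    (hε : 0 < ε) :
    ∃ k : K, k ≠ 0 ∧ v.absValue k < ε ∧ ∀ w, w ≠ v → w.absValue k ≤ 1 ∨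
      w ∈ T ∧ ∀ π : K, w.absValue π < 1 → w.absValue (k * π) ≤ 1 := by
  rcases IsGlobalField.numberField_or_functionField (K := K) with _ | ⟨p, _, _, _⟩
  · exact (hasSmallElements_ringOfIntegers K).exists_absValue_lt_of_infinite hε hT hv
      ((finite_setOf_not_isOver_ringOfIntegers K).subset fun _ hw => hw.2)
  · let : Algebra (ZMod p)[X] K := Algebra.compHom K (algebraMap _ (RatFunc (ZMod p)))
    have : IsScalarTower (ZMod p)[X] (RatFunc (ZMod p)) K := .of_algebraMap_eq fun _ => rfl
    exact (hasSmallElements_integralClosure K p).exists_absValue_lt_of_infinite hε hT hv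
      ((finite_setOf_not_isOver_integralClosure K p).subset fun _ hw => hw.2)

namespace Place

theorem zero_mem_interior_closedUnitBall {K : Type*} [Field K] :
    (w : Place K) → (0 : w.Completion) ∈ interior w.closedUnitBall
  | .infinite w => mem_interior_iff_mem_nhds.2 (mem_of_superset
      (Metric.ball_mem_nhds (0 : w.Completion) one_pos) fun _ hx => (mem_ball_zero_iff.1 hx).le)
  | .finite A hA => by
    rw [interior_closedUnitBall_finite]
    exact zero_mem _

theorem embedding_mul_mem_interior {k : K} (hk : k ≠ 0) : (w : Place K) →
    w.absValue k ≤ 1 → ∀ {z : w.Completion}, z ∈ interior w.closedUnitBall →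
      w.embedding k * z ∈ interior w.closedUnitBall
  | .infinite w => fun hkw z hz => by
    let D := {x : w.Completion | ‖x‖ ≤ 1}
    have hkw' : w k ≤ 1 := (pow_le_one_iff_of_nonneg (apply_nonneg w k) w.mult_ne_zero).1 hkw
    have hk0 : algebraMap K w.Completion k ≠ 0 := (map_ne_zero _).2 hk
    have hopen : IsOpen ((algebraMap K w.Completion k * ·) '' interior D) :=
      (Homeomorph.mulLeft₀ _ hk0).isOpenMap _ isOpen_interior
    refine interior_maximal ?_ hopen ⟨z, hz, rfl⟩
    rintro _ ⟨x, hx, rfl⟩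
    change ‖algebraMap K w.Completion k * x‖ ≤ 1
    rw [norm_mul, norm_algebraMap_infinitePlace_completion]
    exact mul_le_one₀ hkw' (norm_nonneg _) (interior_subset (s := D) hx)
  | .finite A hA => fun hkw z hz => by
    rw [interior_closedUnitBall_finite] at hz ⊢
    refine mul_mem ?_ hz
    change Valued.v (completionEmbedding A k) ≤ 1
    rw [valued_completionEmbedding, A.valuation_le_one_iff]
    exact (absValue_finite_le_one_iff hA).1 hkw

theorem embedding_mul_mem_interior_of_inv_notMem {k : K} : (w : Place K) →
    (∀ π : K, w.absValue π < 1 → w.absValue (k * π) ≤ 1) → ∀ {z : w.Completion},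
      z⁻¹ ∉ w.integers → w.embedding k * z ∈ interior w.closedUnitBall
  | .infinite w => fun _ _ hz => (hz (Subring.mem_top _)).elim
  | .finite A hA => fun hk (z : A.valuation.Completion) hz => by
    have hinv : ¬ Valued.v z⁻¹ ≤ 1 := hz
    have hz0 : z ≠ 0 := fun hz0 => hinv (by simp [hz0])
    have hz1 : Valued.v z < 1 := by
      rwa [map_inv₀, inv_le_one₀ (zero_lt_iff.2 ((map_ne_zero _).2 hz0)), not_le] at hinv
    obtain ⟨π, hπ⟩ := exists_valued_eq_valuation A z
    have hkπ := hk π (absValue_finite_lt_one hA (by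
      rwa [ValuationSubring.mem_nonunits_iff, ← hπ]))
    rw [interior_closedUnitBall_finite]
    change Valued.v (completionEmbedding A k * z) ≤ 1
    rw [map_mul, hπ, valued_completionEmbedding, ← map_mul, A.valuation_le_one_iff]
    exact (absValue_finite_le_one_iff hA).1 hkπ

end Place

theorem smul_mem_unitSpace {y : AdeleRing K} (hy : y v = 0) {k : Kˣ}
    (hk : ∀ w, w ≠ v → w.embedding (k : K) * y w ∈ interior w.closedUnitBall) :
    k • y ∈ unitSpace v := by
  refine ⟨by rw [AdeleRing.smul_apply, hy, mul_zero], fun w => ?_⟩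
  rw [AdeleRing.smul_apply]
  rcases eq_or_ne w v with rfl | hw
  · rw [hy, mul_zero]
    exact w.zero_mem_interior_closedUnitBall
  · exact hk w hw

theorem exists_smul_mem_unitSpace_absValue_lt_of_apply_eq_zero {y : AdeleRing K}
    (hy : y ∈ unitSpace v) {w₀ : Place K} (hw₀ : w₀ ≠ v) (hyw₀ : y w₀ = 0) (hε : 0 < ε) :
    ∃ k : Kˣ, k • y ∈ unitSpace v ∧ v.absValue (k : K) < ε := by
  obtain ⟨k, hk0, hkv, hk⟩ := exists_absValue_lt_of_ne hw₀.symm hε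
  refine ⟨Units.mk0 k hk0, smul_mem_unitSpace hy.1 fun w hwv => ?_, hkv⟩
  rcases eq_or_ne w w₀ with rfl | hww₀
  · rw [hyw₀, mul_zero]
    exact w.zero_mem_interior_closedUnitBall
  · exact w.embedding_mul_mem_interior hk0 (hk w hwv hww₀) (hy.2 w)

theorem exists_smul_mem_unitSpace_absValue_lt_of_infinite {y : AdeleRing K}
    (hy : y ∈ unitSpace v) (hT : {w : Place K | (y w)⁻¹ ∉ w.integers}.Infinite) (hε : 0 < ε) :
    ∃ k : Kˣ, k • y ∈ unitSpace v ∧ v.absValue (k : K) < ε := by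
  have hv : v ∉ {w : Place K | (y w)⁻¹ ∉ w.integers} := fun hv =>
    hv (by rw [hy.1, inv_zero]; exact zero_mem _)
  obtain ⟨k, hk0, hkv, hk⟩ := exists_absValue_lt_of_infinite hT hv hε
  refine ⟨Units.mk0 k hk0, smul_mem_unitSpace hy.1 fun w hwv => ?_, hkv⟩
  rcases hk w hwv with hkw | ⟨hwT, hkw⟩
  · exact w.embedding_mul_mem_interior hk0 hkw (hy.2 w)
  · exact w.embedding_mul_mem_interior_of_inv_notMem hkw hwT

theorem exists_smul_mem_unitSpace_absValue_lt {y : AdeleRing K} (hy : y ∈ unitSpace v)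
    (hyo : adeleClass y ∉ classicalOrbit v) (hε : 0 < ε) :
    ∃ k : Kˣ, k • y ∈ unitSpace v ∧ v.absValue (k : K) < ε := by
  rw [adeleClass_mem_classicalOrbit_iff hy.1, not_and_or, eventually_cofinite] at hyo
  rcases hyo with hzero | hinf
  · push Not at hzero
    obtain ⟨w₀, hw₀, hyw₀⟩ := hzero
    exact exists_smul_mem_unitSpace_absValue_lt_of_apply_eq_zero hy hw₀ hyw₀ hε
  · exact exists_smul_mem_unitSpace_absValue_lt_of_infinite hy hinf hε

theorem mem_classicalOrbit_of_le_energy {y : unitSpace v} {c : ℝ}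
    (hc : ∀ γ, c ≤ energy y γ) : adeleClass (y : AdeleRing K) ∈ classicalOrbit v := by
  by_contra hy
  obtain ⟨k, hky, hk⟩ := exists_smul_mem_unitSpace_absValue_lt y.2 hy (Real.exp_pos c)
  have hck := hc ⟨⟨k, y.1, y.2, hky⟩, rfl⟩
  exact hk.not_ge ((Real.le_log_iff_exp_le (v.absValue_pos k.ne_zero)).1 hck)

end GlobalField

theorem theorem8p11 (K : Type*) [Field K] [IsGlobalField K] (v : Place K) (y : unitSpace v) :
    Implements (regularRep y) (timeEvolution v) (hamiltonian y) ∧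
    (IsBoundedBelow (hamiltonian y) ↔ adeleClass (y : AdeleRing K) ∈ classicalOrbit v) ∧
    (IsPositiveEnergy (regularRep y) (timeEvolution v) ↔
      adeleClass (y : AdeleRing K) ∈ classicalOrbit v) := by
  have himp := implements_hamiltonian y
  have hbdd : adeleClass (y : AdeleRing K) ∈ classicalOrbit v → IsBoundedBelow (hamiltonian y) :=
    fun hy => by
      obtain ⟨c, hc⟩ := exists_le_energy_of_mem_classicalOrbit y hy
      exact isBoundedBelow_hamiltonian y hc
  have hpos : IsPositiveEnergy (regularRep y) (timeEvolution v) →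
      adeleClass (y : AdeleRing K) ∈ classicalOrbit v := fun h => by
    obtain ⟨c, hc⟩ := exists_le_energy_of_isPositiveEnergy h
    exact mem_classicalOrbit_of_le_energy hc
  exact ⟨himp, ⟨fun h => hpos ⟨_, himp, h⟩, hbdd⟩, ⟨hpos, fun h => ⟨_, himp, hbdd h⟩⟩⟩
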